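/- Let $A',B',A,B$ be quantum systems, i.e. nonzero separable Hilbert spaces, of dimensions $|A'|,|B'|,|A|,|B|\in\{1,2,\dots\}\cup\{\infty\}$, and let $\mathcal N_{A'B'\to AB}$ be a bipartite quantum channel (a completely positive, trace-preserving linear map on trace-class operators). Logarithms are to base $2$, $\log\infty=\infty$, and inequalities are between extended real numbers, where $-\infty$ plus anything is $-\infty$. For a state $\rho$ and a positive semidefinite bounded operator $\sigma$ let $D(\rho\Vert\sigma)=\operatorname{tr}[\rho(\log\rho-\log\sigma)]$ if $\operatorname{supp}\rho\subseteq\operatorname{supp}\sigma$ and $D(\rho\Vert\sigma)=+\infty$ otherwise; here the trace is $\sum_{i,j}|\langle e_i|f_j\rangle|^2p_i(\log p_i-\log q_j)$ for spectral decompositions $\rho=\sum_i p_i|e_i\rangle\langle e_i|$ and $\sigma=\sum_j q_j|f_j\rangle\langle f_j|$ (as exist for all operators $\sigma$ below), and an expression $\infty-\infty$, which can only occur when $\operatorname{tr}\sigma=\infty$, is read as $-\infty$. For a channel $\mathcal N$ and a completely positive map $\mathcal M$ with the same input and output systems let $D[\mathcal N\Vert\mathcal M]=\sup_{R,\rho}D\big((\mathrm{id}_R\otimes\mathcal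 N)(\rho)\,\Vert\,(\mathrm{id}_R\otimes\mathcal M)(\rho)\big)$, the supremum being over all separable reference systems $R$ and all states $\rho$ of $R$ and the input system. Let $\mathcal R_{X'\to X}(T)=\operatorname{tr}(T)\,\mathbb 1_X$ be the completely mixing map. Define the von Neumann entropy of the channel and its von Neumann conditional entropy by $$S[AB]_{\mathcal N}=-D[\mathcal N\Vert\mathcal R_{A'B'\to AB}],\qquad S[A|B]_{\mathcal N}=-\inf_{\mathcal M}D[\mathcal N\Vert\mathcal R_{A'\to A}\otimes\mathcal M],$$ where the infimum is over all quantum channels $\mathcal M_{B'\to B}$. Then $$-\log|B|+S[AB]_{\mathcal N}\le S[A|B]_{\mathcal N}\le\log|A|,$$ $$-\log\min\{|A||B|,|A'||B'|\}\le S[AB]_{\mathcal N}\le\log(|A||B|),$$ and consequently $$-\log\min\{|A||B|^2,\,|A'||B'||B|\}\le S[A|B]_{\mathcal N}.$$ -/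

import Mathlib

open scoped ComplexOrder

noncomputable section

namespace QuantumChannel

/-!
A quantum system (separable Hilbert space, of finite or countably infinite dimension) is given by a
countable index type `ι` of an orthonormal basis, its Hilbert space being `ℓ²(ι, ℂ)`; composite
systems are given by product types, and `|A|` is `ENat.card A`.
An operator is given by its (possibly infinite) matrix of entries `T i j = ⟨i|T|j⟩`, which determines
a bounded operator completely. For finite index types these are the usual matrices.
-/

/-- `T` is (the matrix of) a trace-class operator: a complex linear combination of positive
semidefinite operators of finite trace. -/
def IsTraceClass {ι : Type} (T : Matrix ι ι ℂ) : Prop :=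
  T ∈ Submodule.span ℂ {P : Matrix ι ι ℂ | P.PosSemidef ∧ Summable fun i => P i i}

/-- The trace (an absolutely convergent sum for a trace-class operator). -/
def tr {ι : Type} (T : Matrix ι ι ℂ) : ℂ := ∑' i, T i i

/-- Density operators: positive semidefinite with unit trace. -/
def IsState {ι : Type} (ρ : Matrix ι ι ℂ) : Prop :=
  ρ.PosSemidef ∧ HasSum (fun i => ρ i i) 1

/-- The map `id_R ⊗ Φ`: it applies `Φ : L(ι) → L(κ)` to each block
`T_{rs} = (⟨r| ⊗ 1) T (|s⟩ ⊗ 1)` of an operator `T` on `R ⊗ ι`. -/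
def idTensor (R : Type) {ι κ : Type} (Φ : Matrix ι ι ℂ → Matrix κ κ ℂ)
    (T : Matrix (R × ι) (R × ι) ℂ) : Matrix (R × κ) (R × κ) ℂ :=
  Matrix.of fun x y => Φ (T.submatrix (Prod.mk x.1) (Prod.mk y.1)) x.2 y.2

/-- The map `Φ ⊗ id_S`. -/
def tensorId (S : Type) {ι κ : Type} (Φ : Matrix ι ι ℂ → Matrix κ κ ℂ)
    (T : Matrix (ι × S) (ι × S) ℂ) : Matrix (κ × S) (κ × S) ℂ :=
  Matrix.of fun x y => Φ (T.submatrix (fun i => (i, x.2)) (fun i => (i, y.2))) x.1 y.1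

/-- The tensor product `Φ ⊗ Ψ = (Φ ⊗ id) ∘ (id ⊗ Ψ)` of two maps. -/
def tensorMap {ι κ ι' κ' : Type} (Φ : Matrix ι ι ℂ → Matrix κ κ ℂ)
    (Ψ : Matrix ι' ι' ℂ → Matrix κ' κ' ℂ) (T : Matrix (ι × ι') (ι × ι') ℂ) :
    Matrix (κ × κ') (κ × κ') ℂ :=
  tensorId κ' Φ (idTensor ι Ψ T)

/-- A quantum channel from system `ι` to system `κ`: a linear, completely positive and
trace-preserving map on trace-class operators (its values elsewhere are irrelevant). -/
structure Channel (ι κ : Type) where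
  toFun : Matrix ι ι ℂ → Matrix κ κ ℂ
  map_add : ∀ S T, IsTraceClass S → IsTraceClass T → toFun (S + T) = toFun S + toFun T
  map_smul : ∀ (c : ℂ) (T), IsTraceClass T → toFun (c • T) = c • toFun T
  completely_positive : ∀ (n : ℕ) (T : Matrix (Fin n × ι) (Fin n × ι) ℂ),
    T.PosSemidef → IsTraceClass T → (idTensor (Fin n) toFun T).PosSemidef
  trace_preserving : ∀ T, IsTraceClass T → HasSum (fun k => toFun T k k) (tr T)

open Classical in
/-- The completely mixing (completely depolarizing) map `ℛ(X) = tr(X) 1`. -/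
def replacer (ι κ : Type) (T : Matrix ι ι ℂ) : Matrix κ κ ℂ := tr T • (1 : Matrix κ κ ℂ)

/-- A spectral decomposition `T = ∑ⱼ qⱼ |fⱼ⟩⟨fⱼ|` of a positive operator, with `(fⱼ)` a complete
orthonormal system and `qⱼ ≥ 0`. It exists whenever `T` is positive and trace-class, and for
`T = 1 ⊗ ω` with `ω` positive and trace-class. -/
structure SpectralDecomposition {ι : Type} (T : Matrix ι ι ℂ) where
  index : Type
  basis : HilbertBasis index ℂ (lp (fun _ : ι => ℂ) 2)
  eigenvalue : index → ℝ
  eigenvalue_nonneg : ∀ j, 0 ≤ eigenvalue j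
  hasSum : ∀ k l, HasSum
    (fun j => (eigenvalue j : ℂ) * (basis j k * star (basis j l))) (T k l)

/-- The number `w p (log₂ p - log₂ q)` for `w, p, q ≥ 0`,
with `0 log₂ 0 = 0` and value `+∞` if `w p > 0` and `q = 0`. -/
def relEntropyTerm (w p q : ℝ) : EReal :=
  if w * p = 0 then 0 else if q = 0 then ⊤
  else ((w * p * (Real.logb 2 p - Real.logb 2 q) : ℝ) : EReal)

open Classical in
/-- `∑ᵢⱼ |⟨eᵢ|fⱼ⟩|² pᵢ (log₂ pᵢ - log₂ qⱼ)`, i.e. `tr (ρ (log₂ ρ - log₂ σ))` for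
`ρ = ∑ᵢ pᵢ |eᵢ⟩⟨eᵢ|` and `σ = ∑ⱼ qⱼ |fⱼ⟩⟨fⱼ|`. It is `+∞` if some term is, i.e. if the support of `ρ`
is not contained in that of `σ`; otherwise it is the sum of the positive terms minus the sum of the
absolute values of the negative ones. For a state `ρ` the latter is finite whenever `tr σ < ∞`
(a difference `∞ - ∞`, which can only occur for `tr σ = ∞`, is read as `-∞`). -/
def spectralRelEntropy {ι : Type} {ρ σ : Matrix ι ι ℂ}
    (P : SpectralDecomposition ρ) (Q : SpectralDecomposition σ) : EReal :=
  let term : P.index × Q.index → EReal := fun x =>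
    relEntropyTerm (‖inner ℂ (P.basis x.1) (Q.basis x.2)‖ ^ 2)
      (P.eigenvalue x.1) (Q.eigenvalue x.2)
  if ∃ x, term x = ⊤ then ⊤ else
    ((∑' x, (term x).toENNReal : ENNReal) : EReal)
      - ((∑' x, (-term x).toENNReal : ENNReal) : EReal)

/-- The (Umegaki) relative entropy `D(ρ‖σ) = tr (ρ (log₂ ρ - log₂ σ))`, where the value does not
depend on the spectral decompositions that are used to compute it. -/
def relEntropy {ι : Type} (ρ σ : Matrix ι ι ℂ) : EReal :=
  ⨅ (P : SpectralDecomposition ρ) (Q : SpectralDecomposition σ), spectralRelEntropy P Q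

/-- The channel divergence `D[N‖M] = sup D((id_R ⊗ N)(ρ) ‖ (id_R ⊗ M)(ρ))`, over all
reference systems `R` and all states `ρ` of `R` and the input system. -/
def channelDivergence {ι κ : Type} (N M : Matrix ι ι ℂ → Matrix κ κ ℂ) : EReal :=
  ⨆ (R : Type) (_ : Countable R) (ρ : Matrix (R × ι) (R × ι) ℂ) (_ : IsState ρ),
    relEntropy (idTensor R N ρ) (idTensor R M ρ)

/-- The von Neumann entropy `S[N] = - D[N‖ℛ]` of a channel. -/
def entropy {ι κ : Type} (N : Channel ι κ) : EReal :=
  - channelDivergence N.toFun (replacer ι κ)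

/-- The von Neumann conditional entropy `S[A|B]_N = - inf_M D[N ‖ ℛ_{A'→A} ⊗ M]` of a bipartite
channel `N : A'B' → AB`, the infimum being over all channels `M : B' → B`. -/
def condEntropy {A' B' A B : Type} (N : Channel (A' × B') (A × B)) : EReal :=
  - ⨅ M : Channel B' B, channelDivergence N.toFun (tensorMap (replacer A' A) M.toFun)

/-- The binary logarithm of a dimension, with `log₂ ∞ = ∞`. -/
def log2 (d : ℕ∞) : EReal := if d = ⊤ then ⊤ else ((Real.logb 2 (d.toNat : ℝ) : ℝ) : EReal)

end QuantumChannel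

end

/-! All five inequalities come from three facts about the relative entropy of a state `ρ`. Klein's
inequality gives `D(ρ‖σ) ≥ -log tr σ` (`neg_logb_le_relEntropy`); domination `ρ ≤ c σ` gives `D(ρ‖σ)
≤ log c` (`relEntropy_le_logb`); rescaling `σ` by `c` costs at most `-log c` (`relEntropy_smul_le`).

The upper bounds on the entropies need only one input. On a basis state the completely mixing map
has an output of trace `|A||B|`, and its tensor product with any channel `M : B' → B` one of trace
`|A|`; Klein's inequality bounds the divergence from below.

The lower bounds on `S[AB]` need domination. A Choi matrix `J` satisfies `J ≤ tr J · 1 = |A'||B'| ·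
1`, so `N ≤ |A'||B'| ℛ` in the completely positive order (`Channel.posSemidef_card_smul_sub`). The
same statement for the identity channel of the output system, applied to `N(ρ)`, gives the constant
`|A||B|`, because `N` does not change the reduced state on the reference.

For the conditional entropy, `M` is chosen to prepare the maximally mixed state, so that `ℛ ⊗ M =
|B|⁻¹ ℛ` and the divergence grows by at most `log |B|`. The last inequality combines this with the
lower bound on `S[AB]`. A bound that involves an infinite dimension is trivial.

Relative entropy is an infimum over spectral decompositions, so upper bounds also require that
decompositions exist. They are obtained from the spectral theorem for compact operators, applied to
the output state and to the reduced state `ω`; the operator `ω ⊗ 1`, which need not be trace class,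
inherits one from `ω`. -/

namespace QuantumChannel

/-! ### Extended-real sums of signed families, and Tonelli's theorem -/

section SignedSum

variable {α β : Type*}

/-- The sum of the positive parts minus the sum of the negative parts of a real family. -/
noncomputable def signedSum (f : α → ℝ) : EReal :=
  ((∑' x, ENNReal.ofReal (f x) : ENNReal) : EReal)
    - ((∑' x, ENNReal.ofReal (-f x) : ENNReal) : EReal)

theorem signedSum_mono {f g : α → ℝ} (h : ∀ x, f x ≤ g x) : signedSum f ≤ signedSum g := by
  refine EReal.sub_le_sub ?_ ?_
  · exact EReal.coe_ennreal_le_coe_ennreal_iff.2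
      (ENNReal.tsum_le_tsum fun x => ENNReal.ofReal_le_ofReal (h x))
  · exact EReal.coe_ennreal_le_coe_ennreal_iff.2
      (ENNReal.tsum_le_tsum fun x => ENNReal.ofReal_le_ofReal (neg_le_neg (h x)))

theorem signedSum_of_ne_top {f : α → ℝ} (h₁ : ∑' x, ENNReal.ofReal (f x) ≠ ⊤)
    (h₂ : ∑' x, ENNReal.ofReal (-f x) ≠ ⊤) :
    Summable f ∧ signedSum f = ((∑' x, f x : ℝ) : EReal) := by
  have s₁ : Summable fun x => (ENNReal.ofReal (f x)).toReal := ENNReal.summable_toReal h₁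
  have s₂ : Summable fun x => (ENNReal.ofReal (-f x)).toReal := ENNReal.summable_toReal h₂
  have e : ∀ x, f x = (ENNReal.ofReal (f x)).toReal - (ENNReal.ofReal (-f x)).toReal := by
    intro x
    rw [ENNReal.toReal_ofReal', ENNReal.toReal_ofReal', max_zero_sub_eq_self]
  have s : Summable f := (s₁.sub s₂).congr fun x => (e x).symm
  refine ⟨s, ?_⟩
  rw [tsum_congr e, s₁.tsum_sub s₂, signedSum,
    ← ENNReal.tsum_toReal_eq (fun _ => ENNReal.ofReal_ne_top),
    ← ENNReal.tsum_toReal_eq (fun _ => ENNReal.ofReal_ne_top), EReal.coe_sub,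
    EReal.coe_ennreal_toReal h₁, EReal.coe_ennreal_toReal h₂]

theorem tsum_ofReal_ne_top {f : α → ℝ} (h : Summable f) : ∑' x, ENNReal.ofReal (f x) ≠ ⊤ := by
  have := h.abs.tsum_ofReal_ne_top
  exact ne_top_of_le_ne_top this
    (ENNReal.tsum_le_tsum fun x => ENNReal.ofReal_le_ofReal (le_abs_self _))

theorem signedSum_eq {f : α → ℝ} {a : ℝ} (h : HasSum f a) : signedSum f = a := by
  rw [(signedSum_of_ne_top (tsum_ofReal_ne_top h.summable)
    (tsum_ofReal_ne_top h.summable.neg)).2, h.tsum_eq]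

/-- A summable perturbation cannot change which of the two parts diverges. If the negative part of
`f` diverges, the left side is `-∞`; if only the positive part does, the right side is `+∞`;
otherwise everything is summable. -/
theorem signedSum_add_le {f g : α → ℝ} {a : ℝ} (hg : HasSum g a) :
    signedSum (fun x => f x + g x) ≤ signedSum f + a := by
  by_cases h₂ : ∑' x, ENNReal.ofReal (-f x) = ⊤
  · have : ∑' x, ENNReal.ofReal (-(f x + g x)) = ⊤ := by
      by_contra hne
      refine absurd h₂ (ne_top_of_le_ne_top (ENNReal.add_ne_top.2
        ⟨hne, tsum_ofReal_ne_top hg.summable⟩) ?_)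
      rw [← ENNReal.tsum_add]
      refine ENNReal.tsum_le_tsum fun x => ?_
      refine le_trans (ENNReal.ofReal_le_ofReal ?_) ENNReal.ofReal_add_le
      linarith
    rw [signedSum, this]
    simp
  · by_cases h₁ : ∑' x, ENNReal.ofReal (f x) = ⊤
    · rw [signedSum, signedSum, h₁]
      lift (∑' x, ENNReal.ofReal (-f x)) to NNReal using h₂ with b
      have : ((⊤ : ENNReal) : EReal) - (((b : ENNReal)) : EReal) + (a : EReal) = ⊤ := by
        rw [EReal.coe_ennreal_top]
        have : ((b : ENNReal) : EReal) = ((b : ℝ) : EReal) := rfl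
        rw [this, EReal.top_sub_coe, EReal.top_add_coe]
      rw [this]
      exact le_top
    · obtain ⟨s, e⟩ := signedSum_of_ne_top h₁ h₂
      rw [e, signedSum_eq (s.hasSum.add hg), EReal.coe_add]

theorem hasSum_prod_of_nonneg {f : α × β → ℝ} {g : α → ℝ} {a : ℝ} (hf : ∀ x, 0 ≤ f x)
    (h : ∀ i, HasSum (fun j => f (i, j)) (g i)) (hg : HasSum g a) : HasSum f a := by
  have s : Summable f := by
    rw [summable_prod_of_nonneg hf]
    exact ⟨fun i => (h i).summable, hg.summable.congr fun i => ((h i).tsum_eq).symm⟩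
  have := s.hasSum.prod_fiberwise h
  rw [hg.unique this]
  exact s.hasSum

theorem hasSum_prod_of_nonneg_right {f : α × β → ℝ} {g : β → ℝ} {a : ℝ} (hf : ∀ x, 0 ≤ f x)
    (h : ∀ j, HasSum (fun i => f (i, j)) (g j)) (hg : HasSum g a) : HasSum f a :=
  (Equiv.prodComm β α).hasSum_iff.1
    (hasSum_prod_of_nonneg (f := f ∘ Equiv.prodComm β α) (fun _ => hf _) h hg)

theorem hasSum_comm_of_nonneg {f : α × β → ℝ} {g : α → ℝ} {k : β → ℝ} {a : ℝ} (hf : ∀ x, 0 ≤ f x)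
    (h : ∀ i, HasSum (fun j => f (i, j)) (g i)) (h' : ∀ j, HasSum (fun i => f (i, j)) (k j))
    (hg : HasSum g a) : HasSum k a :=
  ((Equiv.prodComm β α).hasSum_iff.2 (hasSum_prod_of_nonneg hf h hg)).prod_fiberwise h'

theorem hasSum_of_sum_le {f : α → ℝ} (hf : ∀ x, 0 ≤ f x) {c : ℝ}
    (h : ∀ s : Finset α, ∑ x ∈ s, f x ≤ c) : ∃ a ≤ c, HasSum f a :=
  have s := summable_of_sum_le hf h
  ⟨_, s.tsum_le_of_sum_le h, s.hasSum⟩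

end SignedSum

/-! ### Klein's inequality and rescaling of the second argument -/

section SpectralRelEntropy

variable {ι : Type}

theorem relEntropyTerm_eq_top_iff {w p q : ℝ} :
    relEntropyTerm w p q = ⊤ ↔ w * p ≠ 0 ∧ q = 0 := by
  unfold relEntropyTerm
  split_ifs with h₁ h₂
  · simp [h₁]
  · simp [h₁, h₂]
  · simp only [EReal.coe_ne_top, false_iff]
    tauto

theorem relEntropyTerm_eq_coe {w p q : ℝ} (h : relEntropyTerm w p q ≠ ⊤) :
    relEntropyTerm w p q = ((w * p * (Real.logb 2 p - Real.logb 2 q) : ℝ) : EReal) := by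
  rw [Ne, relEntropyTerm_eq_top_iff] at h
  unfold relEntropyTerm
  split_ifs with h₁ h₂
  · simp [h₁]
  · tauto
  · rfl

variable {ρ σ : Matrix ι ι ℂ}

/-- The squared overlap `|⟨eᵢ|fⱼ⟩|²` of eigenvectors. -/
noncomputable def overlap (P : SpectralDecomposition ρ) (Q : SpectralDecomposition σ)
    (x : P.index × Q.index) : ℝ :=
  ‖inner ℂ (P.basis x.1) (Q.basis x.2)‖ ^ 2

theorem overlap_nonneg (P : SpectralDecomposition ρ) (Q : SpectralDecomposition σ)
    (x : P.index × Q.index) : 0 ≤ overlap P Q x := sq_nonneg _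

/-- The real number `|⟨eᵢ|fⱼ⟩|² pᵢ (log₂ pᵢ - log₂ qⱼ)`. -/
noncomputable def realTerm (P : SpectralDecomposition ρ) (Q : SpectralDecomposition σ)
    (x : P.index × Q.index) : ℝ :=
  overlap P Q x * P.eigenvalue x.1 *
    (Real.logb 2 (P.eigenvalue x.1) - Real.logb 2 (Q.eigenvalue x.2))

theorem spectralRelEntropy_of_exists {P : SpectralDecomposition ρ} {Q : SpectralDecomposition σ}
    (h : ∃ x : P.index × Q.index, overlap P Q x * P.eigenvalue x.1 ≠ 0 ∧ Q.eigenvalue x.2 = 0) :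
    spectralRelEntropy P Q = ⊤ := by
  obtain ⟨x, hx⟩ := h
  unfold spectralRelEntropy
  exact if_pos ⟨x, relEntropyTerm_eq_top_iff.2 hx⟩

/-- Under the support condition no term is infinite, so all later estimates are termwise comparisons
of real families. -/
theorem spectralRelEntropy_of_forall {P : SpectralDecomposition ρ} {Q : SpectralDecomposition σ}
    (h : ∀ x : P.index × Q.index, overlap P Q x * P.eigenvalue x.1 ≠ 0 → Q.eigenvalue x.2 ≠ 0) :
    spectralRelEntropy P Q = signedSum (realTerm P Q) := by
  have h' : ∀ x : P.index × Q.index, relEntropyTerm (overlap P Q x)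
      (P.eigenvalue x.1) (Q.eigenvalue x.2) ≠ ⊤ := by
    intro x hx
    rw [relEntropyTerm_eq_top_iff] at hx
    exact h x hx.1 hx.2
  have e : ∀ x : P.index × Q.index, relEntropyTerm (‖inner ℂ (P.basis x.1) (Q.basis x.2)‖ ^ 2)
      (P.eigenvalue x.1) (Q.eigenvalue x.2) = ((realTerm P Q x : ℝ) : EReal) :=
    fun x => relEntropyTerm_eq_coe (h' x)
  unfold spectralRelEntropy
  dsimp only
  rw [if_neg (by rintro ⟨x, hx⟩; exact h' x hx)]
  simp only [e, ← EReal.coe_neg, EReal.toENNReal_of_ne_top (EReal.coe_ne_top _), EReal.toReal_coe]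
  rfl

theorem hasSum_norm_sq_apply (v : lp (fun _ : ι => ℂ) 2) :
    HasSum (fun k => ‖v k‖ ^ 2) (‖v‖ ^ 2) := by
  have := lp.hasSum_norm (p := 2) (by norm_num) v
  simpa using this

theorem hilbertBasis_hasSum_norm_sq {J E : Type*} [NormedAddCommGroup E] [InnerProductSpace ℂ E]
    (b : HilbertBasis J ℂ E) (v : E) : HasSum (fun j => ‖inner ℂ (b j) v‖ ^ 2) (‖v‖ ^ 2) := by
  have := Complex.hasSum_re (b.hasSum_inner_mul_inner v v)
  rw [inner_self_eq_norm_sq_to_K] at this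
  convert this using 1
  · ext j
    rw [← inner_conj_symm, Complex.mul_conj, Complex.ofReal_re, Complex.normSq_eq_norm_sq,
      RCLike.norm_conj]
  · simp [← Complex.ofReal_pow]

namespace SpectralDecomposition

theorem norm_basis (P : SpectralDecomposition ρ) (j : P.index) : ‖P.basis j‖ = 1 :=
  P.basis.orthonormal.1 j

/-- Tonelli for the family `pⱼ |eⱼ(k)|²`: summing over `j` first gives the diagonal entries, summing
over `k` first gives the eigenvalues, since the `eⱼ` are unit vectors. -/
theorem hasSum_eigenvalue (P : SpectralDecomposition ρ) {t : ℂ} (h : HasSum (fun k => ρ k k) t) :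
    HasSum P.eigenvalue t.re := by
  refine hasSum_comm_of_nonneg (f := fun x : ι × P.index =>
    P.eigenvalue x.2 * ‖P.basis x.2 x.1‖ ^ 2) (g := fun k => (ρ k k).re)
    (fun x => mul_nonneg (P.eigenvalue_nonneg _) (sq_nonneg _)) ?_ ?_ (Complex.hasSum_re h)
  · intro k
    convert Complex.hasSum_re (P.hasSum k k) using 1
    ext j
    have : P.basis j k * star (P.basis j k) = ((‖P.basis j k‖ ^ 2 : ℝ) : ℂ) := by
      rw [Complex.star_def, Complex.mul_conj, Complex.normSq_eq_norm_sq]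
    rw [this, ← Complex.ofReal_mul, Complex.ofReal_re]
  · intro j
    have := (hasSum_norm_sq_apply (P.basis j)).mul_left (P.eigenvalue j)
    rwa [P.norm_basis, one_pow, mul_one] at this

theorem eigenvalue_le_one (P : SpectralDecomposition ρ) (h : HasSum (fun k => ρ k k) 1)
    (j : P.index) : P.eigenvalue j ≤ 1 :=
  le_hasSum (by simpa using P.hasSum_eigenvalue h) j fun i _ => P.eigenvalue_nonneg i

end SpectralDecomposition

theorem hasSum_overlap_left (P : SpectralDecomposition ρ) (Q : SpectralDecomposition σ)
    (i : P.index) : HasSum (fun j => overlap P Q (i, j)) 1 := by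
  have := hilbertBasis_hasSum_norm_sq Q.basis (P.basis i)
  rw [P.norm_basis, one_pow] at this
  refine this.congr_fun fun j => ?_
  rw [overlap, norm_inner_symm]

theorem hasSum_overlap_right (P : SpectralDecomposition ρ) (Q : SpectralDecomposition σ)
    (j : Q.index) : HasSum (fun i => overlap P Q (i, j)) 1 := by
  have := hilbertBasis_hasSum_norm_sq P.basis (Q.basis j)
  rwa [Q.norm_basis, one_pow] at this

theorem hasSum_overlap_mul_left (P : SpectralDecomposition ρ) (Q : SpectralDecomposition σ) {a : ℝ}
    (h : HasSum P.eigenvalue a) : HasSum (fun x => overlap P Q x * P.eigenvalue x.1) a :=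
  hasSum_prod_of_nonneg (fun _ => mul_nonneg (overlap_nonneg _ _ _) (P.eigenvalue_nonneg _))
    (fun i => by simpa using (hasSum_overlap_left P Q i).mul_right (P.eigenvalue i)) h

theorem hasSum_overlap_mul_right (P : SpectralDecomposition ρ) (Q : SpectralDecomposition σ) {a : ℝ}
    (h : HasSum Q.eigenvalue a) : HasSum (fun x => overlap P Q x * Q.eigenvalue x.2) a :=
  hasSum_prod_of_nonneg_right (fun _ => mul_nonneg (overlap_nonneg _ _ _) (Q.eigenvalue_nonneg _))
    (fun j => by simpa using (hasSum_overlap_right P Q j).mul_right (Q.eigenvalue j)) h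

/-- Klein's inequality in the form `D(ρ‖σ) ≥ -log tr σ`. -/
theorem neg_logb_le_spectralRelEntropy (P : SpectralDecomposition ρ) (Q : SpectralDecomposition σ)
    (hρ : HasSum (fun k => ρ k k) 1) {t : ℝ} (ht : 0 < t) (hσ : HasSum (fun k => σ k k) (t : ℂ)) :
    ((-Real.logb 2 t : ℝ) : EReal) ≤ spectralRelEntropy P Q := by
  by_cases hx : ∃ x : P.index × Q.index,
    overlap P Q x * P.eigenvalue x.1 ≠ 0 ∧ Q.eigenvalue x.2 = 0
  · rw [spectralRelEntropy_of_exists hx]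
    exact le_top
  push Not at hx
  rw [spectralRelEntropy_of_forall hx]
  have hp := hasSum_overlap_mul_left P Q (P.hasSum_eigenvalue hρ)
  have hq := hasSum_overlap_mul_right P Q (Q.hasSum_eigenvalue hσ)
  have h2 : 0 < Real.log 2 := Real.log_pos one_lt_two
  -- The minorant `-wp log t + (wp - wq/t)/ln 2`; its second part sums to zero because `∑ wp = 1`
  -- and `∑ wq = t`.
  have hu := (hp.mul_left (-Real.logb 2 t)).add ((hp.sub (hq.mul_left t⁻¹)).mul_left (Real.log 2)⁻¹)
  rw [Complex.one_re, Complex.ofReal_re, inv_mul_cancel₀ ht.ne', sub_self, mul_zero, add_zero,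
    mul_one] at hu
  rw [← signedSum_eq hu]
  refine signedSum_mono fun x => ?_
  have hw := overlap_nonneg P Q x
  have hp0 := P.eigenvalue_nonneg x.1
  have hq0 := Q.eigenvalue_nonneg x.2
  unfold realTerm
  have hx' := hx x
  generalize overlap P Q x = w at *
  generalize P.eigenvalue x.1 = p at *
  generalize Q.eigenvalue x.2 = q at *
  by_cases hwp : w * p = 0
  · rw [hwp]
    simp only [mul_zero, zero_mul, zero_sub, zero_add]
    have : 0 ≤ (Real.log 2)⁻¹ * (t⁻¹ * (w * q)) := by positivity
    linarith
  have hw' : 0 < w := hw.lt_of_ne' (left_ne_zero_of_mul hwp)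
  have hp' : 0 < p := hp0.lt_of_ne' (right_ne_zero_of_mul hwp)
  have hq' : 0 < q := hq0.lt_of_ne' (hx' hwp)
  -- The point `x = pt/q` makes `wp (1 - 1/x)` equal to `wp - wq/t`.
  have key := Real.one_sub_inv_le_log_of_pos (x := p * t / q) (by positivity)
  rw [Real.log_div (by positivity) hq'.ne', Real.log_mul hp'.ne' ht.ne'] at key
  unfold Real.logb
  have key2 : w * p * (Real.log 2)⁻¹ * (1 - (p * t / q)⁻¹)
    ≤ w * p * (Real.log 2)⁻¹ * (Real.log p + Real.log t - Real.log q) :=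
    mul_le_mul_of_nonneg_left key (by positivity)
  have e : w * p * (Real.log 2)⁻¹ * (1 - (p * t / q)⁻¹)
      = (Real.log 2)⁻¹ * (w * p - t⁻¹ * (w * q)) := by
    field_simp
  rw [e] at key2
  simp only [div_eq_mul_inv]
  linarith

/-- The spectral decomposition of `c σ`. -/
noncomputable def SpectralDecomposition.smul (Q : SpectralDecomposition σ) (c : ℝ) (hc : 0 ≤ c) :
    SpectralDecomposition ((c : ℂ) • σ) where
  index := Q.index
  basis := Q.basis
  eigenvalue j := c * Q.eigenvalue j
  eigenvalue_nonneg j := mul_nonneg hc (Q.eigenvalue_nonneg j)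
  hasSum k l := by
    simpa [mul_assoc] using (Q.hasSum k l).mul_left (c : ℂ)

theorem spectralRelEntropy_smul_le (P : SpectralDecomposition ρ) (Q : SpectralDecomposition σ)
    (hρ : HasSum (fun k => ρ k k) 1) {c : ℝ} (hc : 0 < c) :
    spectralRelEntropy P (Q.smul c hc.le) ≤ spectralRelEntropy P Q + ((-Real.logb 2 c : ℝ) : EReal)
    := by
  by_cases hx : ∃ x : P.index × Q.index,
    overlap P Q x * P.eigenvalue x.1 ≠ 0 ∧ Q.eigenvalue x.2 = 0
  · rw [spectralRelEntropy_of_exists hx, EReal.top_add_coe]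
    exact le_top
  push Not at hx
  rw [spectralRelEntropy_of_forall hx, spectralRelEntropy_of_forall (Q := Q.smul c hc.le)
    fun x h => mul_ne_zero hc.ne' (hx x h)]
  have hp := (hasSum_overlap_mul_left P Q (P.hasSum_eigenvalue hρ)).mul_right (-Real.logb 2 c)
  rw [Complex.one_re, one_mul] at hp
  refine le_trans (signedSum_mono fun x => ?_) (signedSum_add_le hp)
  change overlap P Q x * P.eigenvalue x.1 *
    (Real.logb 2 (P.eigenvalue x.1) - Real.logb 2 (c * Q.eigenvalue x.2)) ≤ _
  unfold realTerm
  by_cases h : overlap P Q x * P.eigenvalue x.1 = 0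
  · simp [h]
  · rw [Real.logb_mul hc.ne' (hx x h)]
    apply le_of_eq
    ring

theorem relEntropy_smul_le (hρ : HasSum (fun k => ρ k k) 1) {c : ℝ} (hc : 0 < c) :
    relEntropy ρ ((c : ℂ) • σ) ≤ relEntropy ρ σ + ((-Real.logb 2 c : ℝ) : EReal) := by
  have : relEntropy ρ ((c : ℂ) • σ) - ((-Real.logb 2 c : ℝ) : EReal) ≤ relEntropy ρ σ := by
    refine le_iInf fun P => le_iInf fun Q => ?_
    rw [EReal.sub_le_iff_le_add (.inl (EReal.coe_ne_bot _)) (.inl (EReal.coe_ne_top _))]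
    exact (iInf₂_le P (Q.smul c hc.le)).trans (spectralRelEntropy_smul_le P Q hρ hc)
  rwa [EReal.sub_le_iff_le_add (.inl (EReal.coe_ne_bot _)) (.inl (EReal.coe_ne_top _))] at this

theorem neg_logb_le_relEntropy (hρ : HasSum (fun k => ρ k k) 1) {t : ℝ} (ht : 0 < t)
    (hσ : HasSum (fun k => σ k k) (t : ℂ)) : ((-Real.logb 2 t : ℝ) : EReal) ≤ relEntropy ρ σ :=
  le_iInf fun P => le_iInf fun Q => neg_logb_le_spectralRelEntropy P Q hρ ht hσ

end SpectralRelEntropy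

/-! ### Relative entropy under an operator inequality `ρ ≤ c σ` -/

section Dominated

variable {ι : Type}

theorem posSemidef_iff_finset {T : Matrix ι ι ℂ} : T.PosSemidef ↔
    T.IsHermitian ∧ ∀ (s : Finset ι) (f : ι → ℂ),
      0 ≤ ∑ i ∈ s, ∑ j ∈ s, star (f i) * T i j * f j := by
  classical
  refine ⟨fun h => ⟨h.1, fun s f => ?_⟩, fun h => ⟨h.1, fun x => h.2 x.support x⟩⟩
  have := h.2 (Finsupp.onFinset s (fun i => if i ∈ s then f i else 0) (by simp +contextual))
  rw [Finsupp.onFinset_sum _ (by simp)] at this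
  refine this.trans_eq (Finset.sum_congr rfl fun i hi => ?_)
  rw [Finsupp.onFinset_sum _ (by simp)]
  refine Finset.sum_congr rfl fun j hj => ?_
  simp [hi, hj]

open Classical in
/-- The vector of `ℓ²` with coordinates `f i` for `i ∈ s` and `0` elsewhere. -/
noncomputable def finVec (s : Finset ι) (f : ι → ℂ) : lp (fun _ : ι => ℂ) 2 :=
  ∑ i ∈ s, lp.single 2 i (f i)

theorem inner_finVec (v : lp (fun _ : ι => ℂ) 2) (s : Finset ι) (f : ι → ℂ) :
    inner ℂ v (finVec s f) = ∑ i ∈ s, star (v i) * f i := by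
  classical
  rw [finVec, inner_sum]
  refine Finset.sum_congr rfl fun i _ => ?_
  rw [lp.inner_single_right]
  simp [mul_comm]

theorem tendsto_finVec (v : lp (fun _ : ι => ℂ) 2) :
    Filter.Tendsto (fun s => finVec s v) Filter.atTop (nhds v) := by
  classical
  have := lp.hasSum_single (p := 2) (by norm_num) v
  simpa only [HasSum, SummationFilter.unconditional_filter, finVec] using! this

variable {ρ σ : Matrix ι ι ℂ}

theorem SpectralDecomposition.hasSum_form (Q : SpectralDecomposition σ) (s : Finset ι)
    (f : ι → ℂ) : HasSum
      (fun j => ((Q.eigenvalue j * ‖inner ℂ (Q.basis j) (finVec s f)‖ ^ 2 : ℝ) : ℂ))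
      (∑ k ∈ s, ∑ l ∈ s, star (f k) * σ k l * f l) := by
  have := hasSum_sum (s := s) fun k _ => hasSum_sum (s := s) fun l _ =>
    ((Q.hasSum k l).mul_left (star (f k))).mul_right (f l)
  refine this.congr_fun fun j => ?_
  rw [inner_finVec, Complex.ofReal_mul, ← Complex.normSq_eq_norm_sq, ← Complex.mul_conj, map_sum,
    mul_comm (∑ i ∈ s, _), Finset.sum_mul_sum, Finset.mul_sum]
  refine Finset.sum_congr rfl fun k _ => ?_
  rw [Finset.mul_sum]
  refine Finset.sum_congr rfl fun l _ => ?_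
  simp only [map_mul, Complex.star_def, Complex.conj_conj]
  ring

/-- The square root of `σ = ∑ⱼ qⱼ |fⱼ⟩⟨fⱼ|`, followed by the coordinate map of the eigenbasis. -/
theorem SpectralDecomposition.exists_sqrt (Q : SpectralDecomposition σ)
    (hQ : ∀ j, Q.eigenvalue j ≤ 1) :
    ∃ Φ : lp (fun _ : ι => ℂ) 2 →L[ℂ] lp (fun _ : Q.index => ℂ) 2,
      ∀ v, HasSum (fun j => Q.eigenvalue j * ‖inner ℂ (Q.basis j) v‖ ^ 2) (‖Φ v‖ ^ 2) := by
  have hn : ∀ v j, ‖((Real.sqrt (Q.eigenvalue j) : ℝ) : ℂ) * inner ℂ (Q.basis j) v‖ ^ 2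
      = Q.eigenvalue j * ‖inner ℂ (Q.basis j) v‖ ^ 2 := by
    intro v j
    rw [norm_mul, mul_pow, Complex.norm_real, Real.norm_eq_abs, sq_abs,
      Real.sq_sqrt (Q.eigenvalue_nonneg j)]
  have hle : ∀ v j, Q.eigenvalue j * ‖inner ℂ (Q.basis j) v‖ ^ 2 ≤ ‖inner ℂ (Q.basis j) v‖ ^ 2 :=
    fun v j => mul_le_of_le_one_left (sq_nonneg _) (hQ j)
  have hmem : ∀ v, Memℓp (fun j => ((Real.sqrt (Q.eigenvalue j) : ℝ) : ℂ) * inner ℂ (Q.basis j) v)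
      2 := by
    intro v
    rw [memℓp_gen_iff (by norm_num)]
    simp only [ENNReal.toReal_ofNat, Real.rpow_ofNat, hn]
    exact (hilbertBasis_hasSum_norm_sq Q.basis v).summable.of_nonneg_of_le
      (fun j => mul_nonneg (Q.eigenvalue_nonneg j) (sq_nonneg _)) (hle v)
  let L : lp (fun _ : ι => ℂ) 2 →ₗ[ℂ] lp (fun _ : Q.index => ℂ) 2 :=
    { toFun := fun v => ⟨_, hmem v⟩
      map_add' := fun v w => by
        refine Subtype.ext (funext fun j => ?_)
        change _ * inner ℂ _ (v + w) = _ * inner ℂ _ v + _ * inner ℂ _ w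
        rw [inner_add_right, mul_add]
      map_smul' := fun c v => by
        refine Subtype.ext (funext fun j => ?_)
        change _ * inner ℂ _ (c • v) = c * (_ * inner ℂ _ v)
        rw [inner_smul_right, mul_left_comm] }
  have hL : ∀ v, HasSum (fun j => Q.eigenvalue j * ‖inner ℂ (Q.basis j) v‖ ^ 2) (‖L v‖ ^ 2) := by
    intro v
    have := hasSum_norm_sq_apply (L v)
    simp only [← hn]
    exact this
  refine ⟨L.mkContinuous 1 fun v => ?_, hL⟩
  rw [one_mul]
  exact (sq_le_sq₀ (norm_nonneg _) (norm_nonneg _)).1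
    (hasSum_le (hle v) (hL v) (hilbertBasis_hasSum_norm_sq Q.basis v))

/-- If `ρ ≤ c σ` then `pᵢ |⟨eᵢ|v⟩|² ≤ c ⟨v|σ|v⟩` for every vector `v`. -/
theorem eigenvalue_mul_norm_inner_sq_le (P : SpectralDecomposition ρ) (Q : SpectralDecomposition σ)
    (hQ : ∀ j, Q.eigenvalue j ≤ 1) {c : ℝ}
    (h : ((c : ℂ) • σ - ρ).PosSemidef) (i : P.index) (v : lp (fun _ : ι => ℂ) 2) {a : ℝ}
    (ha : HasSum (fun j => Q.eigenvalue j * ‖inner ℂ (Q.basis j) v‖ ^ 2) a) :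
    P.eigenvalue i * ‖inner ℂ (P.basis i) v‖ ^ 2 ≤ c * a := by
  -- The matrix inequality only speaks of finitely supported vectors. Writing `⟨v|σ|v⟩ = ‖Φ v‖²`
  -- with `Φ` bounded makes both sides continuous in `v`, so that truncations of `v` can be passed
  -- to the limit.
  obtain ⟨Φ, hΦ⟩ := Q.exists_sqrt hQ
  rw [ha.unique (hΦ v)]
  have h₁ : Filter.Tendsto (fun s => P.eigenvalue i * ‖inner ℂ (P.basis i) (finVec s v)‖ ^ 2)
      Filter.atTop (nhds (P.eigenvalue i * ‖inner ℂ (P.basis i) v‖ ^ 2)) :=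
    Filter.Tendsto.comp (g := fun w => P.eigenvalue i * ‖inner ℂ (P.basis i) w‖ ^ 2)
      (Continuous.tendsto (by fun_prop) _) (tendsto_finVec v)
  have h₂ : Filter.Tendsto (fun s => c * ‖Φ (finVec s v)‖ ^ 2)
      Filter.atTop (nhds (c * ‖Φ v‖ ^ 2)) :=
    Filter.Tendsto.comp (g := fun w => c * ‖Φ w‖ ^ 2)
      (Continuous.tendsto (by fun_prop) _) (tendsto_finVec v)
  refine le_of_tendsto_of_tendsto' h₁ h₂ fun s => ?_
  have hP := Complex.hasSum_re (P.hasSum_form s v)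
  simp only [Complex.ofReal_re] at hP
  have hpos := (posSemidef_iff_finset.1 h).2 s v
  have e : ∑ i ∈ s, ∑ j ∈ s, star (v i) * ((c : ℂ) • σ - ρ) i j * v j
      = (c : ℂ) * (∑ i ∈ s, ∑ j ∈ s, star (v i) * σ i j * v j)
        - ∑ i ∈ s, ∑ j ∈ s, star (v i) * ρ i j * v j := by
    simp only [Finset.mul_sum, ← Finset.sum_sub_distrib]
    refine Finset.sum_congr rfl fun k _ => Finset.sum_congr rfl fun l _ => ?_
    simp only [Matrix.sub_apply, Matrix.smul_apply, smul_eq_mul]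
    ring
  rw [e, Complex.nonneg_iff] at hpos
  have hre := hpos.1
  rw [Complex.sub_re, Complex.re_ofReal_mul] at hre
  have hi := le_hasSum hP i fun k _ => mul_nonneg (P.eigenvalue_nonneg k) (sq_nonneg _)
  have := (Complex.hasSum_re (Q.hasSum_form s v)).unique (hΦ (finVec s v))
  rw [← this]
  linarith

/-- The test vector is `v = fⱼ`. For `qⱼ = 0` this yields the support inclusion that rules out the
value `+∞`. -/
theorem eigenvalue_mul_overlap_le (P : SpectralDecomposition ρ) (Q : SpectralDecomposition σ)
    (hQ : ∀ j, Q.eigenvalue j ≤ 1) {c : ℝ}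
    (h : ((c : ℂ) • σ - ρ).PosSemidef) (i : P.index) (j : Q.index) :
    P.eigenvalue i * overlap P Q (i, j) ≤ c * Q.eigenvalue j := by
  classical
  refine eigenvalue_mul_norm_inner_sq_le P Q hQ h i (Q.basis j) ?_
  convert hasSum_ite_eq j (Q.eigenvalue j) using 2 with k
  rw [orthonormal_iff_ite.1 Q.basis.orthonormal]
  split_ifs with hk <;> simp [hk]

/-- This is `pᵢ ⟨eᵢ|σ⁻¹|eᵢ⟩ ≤ c`, truncated to finitely many eigenvectors of `σ`. The test vector is
the truncation `v` of `σ⁻¹ eᵢ`: both `⟨eᵢ|v⟩` and `⟨v|σ|v⟩` equal the truncated sum `A`, so `pᵢ A² ≤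
c A`. Zero eigenvalues contribute nothing, as inversion sends zero to zero. -/
theorem eigenvalue_mul_sum_overlap_div_le (P : SpectralDecomposition ρ)
    (Q : SpectralDecomposition σ) (hQ : ∀ j, Q.eigenvalue j ≤ 1) {c : ℝ} (hc : 0 ≤ c)
    (h : ((c : ℂ) • σ - ρ).PosSemidef) (i : P.index) (s : Finset Q.index) :
    P.eigenvalue i * ∑ j ∈ s, overlap P Q (i, j) / Q.eigenvalue j ≤ c := by
  classical
  set A := ∑ j ∈ s, overlap P Q (i, j) / Q.eigenvalue j with hA
  have hA0 : 0 ≤ A :=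
    Finset.sum_nonneg fun j _ => div_nonneg (overlap_nonneg _ _ _) (Q.eigenvalue_nonneg j)
  set l : Q.index → ℂ := fun j => ((Q.eigenvalue j)⁻¹ : ℝ) * inner ℂ (Q.basis j) (P.basis i)
  have ho : ∀ j, inner ℂ (Q.basis j) (∑ k ∈ s, l k • Q.basis k) = if j ∈ s then l j else 0 := by
    intro j
    simp_rw [inner_sum, inner_smul_right, orthonormal_iff_ite.1 Q.basis.orthonormal]
    simp
  have hov : ∀ j, overlap P Q (i, j) = ‖inner ℂ (Q.basis j) (P.basis i)‖ ^ 2 := by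
    intro j
    rw [overlap, norm_inner_symm]
  have key := eigenvalue_mul_norm_inner_sq_le P Q hQ h i (∑ k ∈ s, l k • Q.basis k) (a := A) ?_
  · have e : inner ℂ (P.basis i) (∑ k ∈ s, l k • Q.basis k) = (A : ℂ) := by
      rw [inner_sum, hA, Complex.ofReal_sum]
      refine Finset.sum_congr rfl fun j _ => ?_
      rw [inner_smul_right, hov, ← inner_conj_symm (P.basis i), mul_assoc, Complex.mul_conj,
        Complex.normSq_eq_norm_sq, ← Complex.ofReal_mul, div_eq_inv_mul]
    rw [e, Complex.norm_real, Real.norm_eq_abs, sq_abs] at key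
    rcases hA0.eq_or_lt with h0 | h0
    · rw [← h0, mul_zero]
      exact hc
    · exact le_of_mul_le_mul_right (by linarith [sq A]) h0
  · have : ∀ j ∉ s, Q.eigenvalue j * ‖inner ℂ (Q.basis j) (∑ k ∈ s, l k • Q.basis k)‖ ^ 2 = 0 := by
      intro j hj
      simp [ho, hj]
    convert hasSum_sum_of_ne_finset_zero (L := SummationFilter.unconditional _) this using 1
    rw [hA]
    refine Finset.sum_congr rfl fun j hj => ?_
    rw [ho, if_pos hj, norm_mul, mul_pow, Complex.norm_real, Real.norm_eq_abs, sq_abs, hov]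
    by_cases hq : Q.eigenvalue j = 0
    · simp [hq]
    · field_simp

/-- If `ρ ≤ c σ` then `D(ρ‖σ) ≤ log c`. -/
theorem spectralRelEntropy_le_logb (P : SpectralDecomposition ρ) (Q : SpectralDecomposition σ)
    (hρ : HasSum (fun k => ρ k k) 1) (hQ : ∀ j, Q.eigenvalue j ≤ 1) {c : ℝ} (hc : 0 < c)
    (h : ((c : ℂ) • σ - ρ).PosSemidef) :
    spectralRelEntropy P Q ≤ ((Real.logb 2 c : ℝ) : EReal) := by
  have hpos : ∀ x : P.index × Q.index, overlap P Q x * P.eigenvalue x.1 ≠ 0 →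
      Q.eigenvalue x.2 ≠ 0 := by
    intro x hx hq
    have := eigenvalue_mul_overlap_le P Q hQ h x.1 x.2
    rw [hq, mul_zero, mul_comm] at this
    exact hx (this.antisymm (mul_nonneg (overlap_nonneg _ _ _) (P.eigenvalue_nonneg _)))
  have hp1 := P.hasSum_eigenvalue hρ
  rw [Complex.one_re] at hp1
  have hp := hasSum_overlap_mul_left P Q hp1
  -- Here `r i` stands for `pᵢ ⟨eᵢ|σ⁻¹|eᵢ⟩`, which is at most `c`.
  choose r hr hr' using fun i => hasSum_of_sum_le
    (f := fun j => P.eigenvalue i * (overlap P Q (i, j) / Q.eigenvalue j))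
    (fun j => mul_nonneg (P.eigenvalue_nonneg i)
      (div_nonneg (overlap_nonneg _ _ _) (Q.eigenvalue_nonneg j)))
    (fun s => by
      rw [← Finset.mul_sum]
      exact eigenvalue_mul_sum_overlap_div_le P Q hQ hc.le h i s)
  have hr0 : ∀ i, 0 ≤ r i := fun i => (hr' i).nonneg fun j => mul_nonneg (P.eigenvalue_nonneg i)
      (div_nonneg (overlap_nonneg _ _ _) (Q.eigenvalue_nonneg j))
  have hb : ∀ i, P.eigenvalue i * (r i / c) ≤ P.eigenvalue i := fun i =>
    mul_le_of_le_one_right (P.eigenvalue_nonneg i) ((div_le_one hc).2 (hr i))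
  have hs : Summable fun i => P.eigenvalue i * (r i / c) := hp1.summable.of_nonneg_of_le
    (fun i => mul_nonneg (P.eigenvalue_nonneg i) (div_nonneg (hr0 i) hc.le)) hb
  have hs1 : ∑' i, P.eigenvalue i * (r i / c) ≤ 1 := hasSum_le hb hs.hasSum hp1
  have hm : HasSum (fun x : P.index × Q.index => P.eigenvalue x.1 *
      (P.eigenvalue x.1 * (overlap P Q x / Q.eigenvalue x.2) / c))
      (∑' i, P.eigenvalue i * (r i / c)) :=
    hasSum_prod_of_nonneg
      (fun x => mul_nonneg (P.eigenvalue_nonneg _) (div_nonneg (mul_nonneg (P.eigenvalue_nonneg _)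
        (div_nonneg (overlap_nonneg _ _ _) (Q.eigenvalue_nonneg _))) hc.le))
      (fun i => ((hr' i).div_const c).mul_left (P.eigenvalue i)) hs.hasSum
  have h2 : 0 < Real.log 2 := Real.log_pos one_lt_two
  -- The majorant that `ln x ≤ x - 1` gives at `x = p/(cq)`. Its sum is `log c` plus a multiple of
  -- `∑ pᵢ rᵢ/c - 1`, which is not positive.
  have hu := (hp.mul_left (Real.logb 2 c)).add ((hm.sub hp).mul_left (Real.log 2)⁻¹)
  rw [spectralRelEntropy_of_forall hpos]
  refine (signedSum_mono (g := fun x => _) fun x => ?_).trans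
    ((signedSum_eq hu).trans_le (EReal.coe_le_coe_iff.2 ?_))
  · have hw := overlap_nonneg P Q x
    have hp0 := P.eigenvalue_nonneg x.1
    have hq0 := Q.eigenvalue_nonneg x.2
    unfold realTerm
    have hx' := hpos x
    generalize overlap P Q x = w at *
    generalize P.eigenvalue x.1 = p at *
    generalize Q.eigenvalue x.2 = q at *
    by_cases hwp : w * p = 0
    · rcases mul_eq_zero.1 hwp with rfl | rfl <;> simp
    have hw' : 0 < w := hw.lt_of_ne' (left_ne_zero_of_mul hwp)
    have hp' : 0 < p := hp0.lt_of_ne' (right_ne_zero_of_mul hwp)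
    have hq' : 0 < q := hq0.lt_of_ne' (hx' hwp)
    have key := Real.log_le_sub_one_of_pos (x := p / (c * q)) (by positivity)
    rw [Real.log_div hp'.ne' (by positivity), Real.log_mul hc.ne' hq'.ne'] at key
    have key2 := mul_le_mul_of_nonneg_left key (by positivity : 0 ≤ w * p * (Real.log 2)⁻¹)
    have e : w * p * (Real.log 2)⁻¹ * (p / (c * q) - 1)
        = (Real.log 2)⁻¹ * (p * (p * (w / q) / c) - w * p) := by
      field_simp
    rw [e] at key2
    simp only [Real.logb, div_eq_mul_inv] at key2 ⊢
    linarith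
  · have : (Real.log 2)⁻¹ * (∑' i, P.eigenvalue i * (r i / c) - 1) ≤ 0 :=
      mul_nonpos_of_nonneg_of_nonpos (by positivity) (by linarith)
    linarith

theorem relEntropy_le_logb (P : SpectralDecomposition ρ) (Q : SpectralDecomposition σ)
    (hρ : HasSum (fun k => ρ k k) 1) (hQ : ∀ j, Q.eigenvalue j ≤ 1) {c : ℝ} (hc : 0 < c)
    (h : ((c : ℂ) • σ - ρ).PosSemidef) : relEntropy ρ σ ≤ ((Real.logb 2 c : ℝ) : EReal) :=
  (iInf₂_le P Q).trans (spectralRelEntropy_le_logb P Q hρ hQ hc h)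

end Dominated

/-! ### Existence of spectral decompositions -/

section SpectralTheorem

variable {ι : Type}

theorem apply_self_eq_ofReal {T : Matrix ι ι ℂ} (hT : T.PosSemidef) (i : ι) :
    T i i = ((T i i).re : ℂ) :=
  (Complex.eq_re_of_ofReal_le (r := 0) (by simpa using hT.diag_nonneg (i := i)))

theorem re_apply_self_nonneg {T : Matrix ι ι ℂ} (hT : T.PosSemidef) (i : ι) : 0 ≤ (T i i).re :=
  (Complex.nonneg_iff.1 (hT.diag_nonneg (i := i))).1

/-- The principal 2×2 minor on `i, j` has nonnegative determinant. -/
theorem norm_apply_sq_le {T : Matrix ι ι ℂ} (hT : T.PosSemidef) (i j : ι) :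
    ‖T i j‖ ^ 2 ≤ (T i i).re * (T j j).re := by
  have h := (hT.submatrix ![i, j]).det_nonneg
  rw [Matrix.det_fin_two] at h
  simp only [Matrix.submatrix_apply, Matrix.cons_val_zero, Matrix.cons_val_one] at h
  rw [← hT.1.apply j i, Complex.star_def, Complex.mul_conj, apply_self_eq_ofReal hT i,
    apply_self_eq_ofReal hT j, ← Complex.ofReal_mul, ← Complex.ofReal_sub, Complex.zero_le_real,
    Complex.normSq_eq_norm_sq] at h
  linarith

/-- A family of vectors with square-summable norms is the family of rows of a compact operator. -/
theorem exists_isCompactOperator_apply_eq_inner {E : Type*} [NormedAddCommGroup E]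
    [InnerProductSpace ℂ E] (row : ι → E) (h : Summable fun i => ‖row i‖ ^ 2) :
    ∃ S : E →L[ℂ] lp (fun _ : ι => ℂ) 2, IsCompactOperator S ∧
      ∀ v i, S v i = inner ℂ (row i) v := by
  classical
  let F : ι → E →L[ℂ] lp (fun _ : ι => ℂ) 2 := fun i =>
    (ContinuousLinearMap.toSpanSingleton ℂ (lp.single 2 i (1 : ℂ))).comp (innerSL ℂ (row i))
  have hF : ∀ (s : Finset ι) v, (∑ i ∈ s, F i) v = ∑ i ∈ s, lp.single 2 i (inner ℂ (row i) v) := by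
    intro s v
    rw [sum_apply]
    refine Finset.sum_congr rfl fun i _ => ?_
    simp only [F, ContinuousLinearMap.comp_apply, ContinuousLinearMap.toSpanSingleton_apply,
      innerSL_apply_apply]
    rw [← lp.single_smul, smul_eq_mul, mul_one]
  -- The operator norm is at most the Hilbert–Schmidt norm. Hence the finite-rank partial sums
  -- converge in operator norm, and their limit is compact.
  have hn : ∀ s : Finset ι, ‖∑ i ∈ s, F i‖ ≤ Real.sqrt (∑ i ∈ s, ‖row i‖ ^ 2) := by
    intro s
    refine ContinuousLinearMap.opNorm_le_bound _ (Real.sqrt_nonneg _) fun v => ?_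
    refine (sq_le_sq₀ (norm_nonneg _) (by positivity)).1 ?_
    have e := lp.norm_sum_single (p := 2) (by norm_num) (fun i => (inner ℂ (row i) v : ℂ)) s
    simp only [ENNReal.toReal_ofNat, Real.rpow_ofNat] at e
    rw [hF, e, mul_pow, Real.sq_sqrt (Finset.sum_nonneg fun _ _ => sq_nonneg _), Finset.sum_mul]
    refine Finset.sum_le_sum fun i _ => ?_
    rw [← mul_pow]
    exact pow_le_pow_left₀ (norm_nonneg _) (norm_inner_le_norm _ _) 2
  have hs : Summable F := by
    rw [summable_iff_vanishing_norm]
    intro ε hε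
    obtain ⟨s, hs⟩ := summable_iff_vanishing_norm.1 h (ε ^ 2) (by positivity)
    refine ⟨s, fun t ht => (hn t).trans_lt ?_⟩
    rw [Real.sqrt_lt' hε]
    exact (le_abs_self _).trans_lt (hs t ht)
  refine ⟨∑' i, F i, ?_, fun v i => ?_⟩
  · have ht : Filter.Tendsto (fun s => ∑ i ∈ s, F i) Filter.atTop (nhds (∑' i, F i)) := by
      simpa only [HasSum, SummationFilter.unconditional_filter] using hs.hasSum
    refine isCompactOperator_of_tendsto ht (.of_forall fun s => ?_)
    have hc : ∀ i, F i ∈ compactOperator (RingHom.id ℂ) E (lp (fun _ : ι => ℂ) 2) := by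
      intro i
      have h := isCompactOperator_of_locallyCompactSpace_rng
        (ContinuousLinearMap.toSpanSingleton ℂ
          (lp.single 2 i (1 : ℂ) : lp (fun _ : ι => ℂ) 2))
      exact h.comp_clm (innerSL ℂ (row i))
    exact Submodule.sum_mem _ fun i _ => hc i
  · have h₁ := ((hs.hasSum.mapL (ContinuousLinearMap.apply ℂ _ v))).mapL
      (innerSL ℂ (lp.single 2 i (1 : ℂ)))
    simp only [ContinuousLinearMap.apply_apply, innerSL_apply_apply, lp.inner_single_left] at h₁
    have h₂ : ∀ k, inner ℂ (1 : ℂ) (F k v i) = if k = i then inner ℂ (row i) v else 0 := by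
      intro k
      have := hF {k} v
      rw [Finset.sum_singleton, Finset.sum_singleton] at this
      rw [this, lp.single_apply, Pi.single_apply]
      by_cases hk : k = i
      · subst hk
        simp
      · simp [hk, Ne.symm hk]
    simp only [h₂] at h₁
    simpa using h₁.unique (hasSum_ite_eq i _)

/-- A positive semidefinite matrix of finite trace represents a compact operator on `ℓ²`. -/
theorem exists_isCompactOperator_inner_single {T : Matrix ι ι ℂ} [DecidableEq ι]
    (hT : T.PosSemidef) (hs : Summable fun i => T i i) :
    ∃ S : lp (fun _ : ι => ℂ) 2 →L[ℂ] lp (fun _ : ι => ℂ) 2, IsCompactOperator S ∧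
      ∀ i j, S (lp.single 2 j 1) i = T i j := by
  have hs' : Summable fun i => (T i i).re := (Complex.hasSum_re hs.hasSum).summable
  have hrow : ∀ i, Summable fun j => ‖star (T i j)‖ ^ 2 := fun i =>
    (hs'.mul_left (T i i).re).of_nonneg_of_le (fun _ => sq_nonneg _)
      fun j => by simpa using norm_apply_sq_le hT i j
  have hmem : ∀ i, Memℓp (fun j => star (T i j)) 2 := by
    intro i
    rw [memℓp_gen_iff (by norm_num)]
    simpa only [ENNReal.toReal_ofNat, Real.rpow_ofNat] using hrow i
  let row : ι → lp (fun _ : ι => ℂ) 2 := fun i => ⟨_, hmem i⟩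
  have hn : ∀ i, ‖row i‖ ^ 2 ≤ (T i i).re * ∑' j, (T j j).re := fun i =>
    hasSum_le (fun j => by simpa [row] using norm_apply_sq_le hT i j)
      (hasSum_norm_sq_apply (row i)) (hs'.hasSum.mul_left _)
  obtain ⟨S, hS, hS'⟩ := exists_isCompactOperator_apply_eq_inner row
    ((hs'.mul_right _).of_nonneg_of_le (fun _ => sq_nonneg _) hn)
  refine ⟨S, hS, fun i j => ?_⟩
  rw [hS', lp.inner_single_right]
  simp [row]

theorem isSymmetric_of_isHermitian {T : Matrix ι ι ℂ} [DecidableEq ι] (hT : T.IsHermitian)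
    {S : lp (fun _ : ι => ℂ) 2 →L[ℂ] lp (fun _ : ι => ℂ) 2}
    (hS : ∀ i j, S (lp.single 2 j 1) i = T i j) : S.IsSymmetric := by
  rw [← ContinuousLinearMap.isSelfAdjoint_iff_isSymmetric, ContinuousLinearMap.isSelfAdjoint_iff']
  refine lp.ext_continuousLinearMap (by norm_num) fun j => ?_
  ext i
  simp only [ContinuousLinearMap.comp_apply, lp.singleContinuousLinearMap_apply]
  have h : ∀ v : lp (fun _ : ι => ℂ) 2, v i = inner ℂ (lp.single 2 i (1 : ℂ)) v := by
    intro v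
    rw [lp.inner_single_left]
    simp
  rw [h, ContinuousLinearMap.adjoint_inner_right, lp.inner_single_right, hS, hS]
  simpa using hT.apply i j

theorem re_inner_apply_self_nonneg {T : Matrix ι ι ℂ} [DecidableEq ι] (hT : T.PosSemidef)
    {S : lp (fun _ : ι => ℂ) 2 →L[ℂ] lp (fun _ : ι => ℂ) 2}
    (hS : ∀ i j, S (lp.single 2 j 1) i = T i j) (v : lp (fun _ : ι => ℂ) 2) :
    0 ≤ RCLike.re (inner ℂ v (S v)) := by
  have ht : Filter.Tendsto (fun s => RCLike.re (inner ℂ (finVec s v) (S (finVec s v))))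
      Filter.atTop (nhds (RCLike.re (inner ℂ v (S v)))) :=
    Filter.Tendsto.comp (g := fun w => RCLike.re (inner ℂ w (S w)))
      (Continuous.tendsto (by fun_prop) _) (tendsto_finVec v)
  refine ge_of_tendsto' ht fun s => ?_
  have e : inner ℂ (finVec s v) (S (finVec s v))
      = ∑ i ∈ s, ∑ j ∈ s, star (v i) * T i j * v j := by
    rw [← inner_conj_symm, inner_finVec, map_sum]
    refine Finset.sum_congr rfl fun i _ => ?_
    have hj : ∀ j, (lp.single 2 j (v j) : lp (fun _ : ι => ℂ) 2) = v j • lp.single 2 j 1 := by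
      intro j
      rw [← lp.single_smul, smul_eq_mul, mul_one]
    have : S (finVec s v) i = ∑ j ∈ s, T i j * v j := by
      have : finVec s v = ∑ j ∈ s, v j • (lp.single 2 j 1 : lp (fun _ : ι => ℂ) 2) := by
        rw [finVec]
        refine Finset.sum_congr rfl fun j _ => ?_
        convert hj j
      rw [this, map_sum, lp.coeFn_sum, Finset.sum_apply]
      refine Finset.sum_congr rfl fun j _ => ?_
      rw [map_smul, lp.coeFn_smul, Pi.smul_apply, hS, smul_eq_mul, mul_comm]
    rw [this, map_mul, Complex.star_def, Complex.conj_conj, mul_comm, Finset.mul_sum]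
    exact Finset.sum_congr rfl fun j _ => (mul_assoc _ _ _).symm
  rw [e]
  exact (Complex.nonneg_iff.1 ((posSemidef_iff_finset.1 hT).2 s v)).1

/-- A compact symmetric operator on a Hilbert space has an orthonormal basis of eigenvectors. -/
theorem exists_hilbertBasis_eigenvectors {E : Type} [NormedAddCommGroup E]
    [InnerProductSpace ℂ E] [CompleteSpace E] {S : E →L[ℂ] E} (hc : IsCompactOperator S)
    (hs : S.IsSymmetric) :
    ∃ (J : Type) (b : HilbertBasis J ℂ E) (q : J → ℝ), ∀ j, S (b j) = (q j : ℂ) • b j := by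
  let V : ℂ → Submodule ℂ E := fun μ => Module.End.eigenspace (S : Module.End ℂ E) μ
  have hV : OrthogonalFamily ℂ (fun μ => V μ) fun μ => (V μ).subtypeₗᵢ :=
    hs.orthogonalFamily_eigenspaces
  have hcomp : ∀ μ, CompleteSpace (V μ) := by
    intro μ
    have : IsClosed (V μ : Set E) := by
      have : (V μ : Set E) = {v | S v = μ • v} := by
        ext v
        exact Module.End.mem_eigenspace_iff
      rw [this]
      exact isClosed_eq (by fun_prop) (by fun_prop)
    exact this.completeSpace_coe
  -- Bases of all eigenspaces are glued together, with `μ` ranging over all complex numbers; a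
  -- trivial eigenspace contributes an empty basis.
  choose w b hb using fun μ => exists_hilbertBasis ℂ (V μ)
  have ho := hV.orthonormal_sigma_orthonormal (fun μ => (b μ).orthonormal)
  let J := Σ μ, w μ
  let e : J → E := fun a => (V a.1).subtypeₗᵢ (b a.1 a.2)
  have hspan : (Submodule.span ℂ (Set.range e))ᗮ = ⊥ := by
    rw [eq_bot_iff]
    intro x hx
    rw [← S.orthogonalComplement_iSup_eigenspaces_eq_bot hc hs, ← Submodule.iInf_orthogonal,
      Submodule.mem_iInf]
    intro μ
    rw [Submodule.mem_orthogonal]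
    intro v hv
    have h₁ := ((b μ).hasSum_repr ⟨v, hv⟩).mapL (V μ).subtypeL
    have h₂ := h₁.mapL (innerSL ℂ x)
    have h₃ : ∀ j, inner ℂ x ((b μ j : V μ) : E) = 0 := by
      intro j
      rw [inner_eq_zero_symm]
      exact (Submodule.mem_orthogonal _ _).1 hx _ (Submodule.subset_span ⟨⟨μ, j⟩, rfl⟩)
    simp only [Submodule.subtypeL_apply, innerSL_apply_apply, Submodule.coe_smul, inner_smul_right,
      h₃, mul_zero] at h₂
    rw [inner_eq_zero_symm]
    exact h₂.unique hasSum_zero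
  refine ⟨J, HilbertBasis.mkOfOrthogonalEqBot ho hspan, fun j => j.1.re, fun j => ?_⟩
  rw [HilbertBasis.coe_mkOfOrthogonalEqBot]
  have hj : S (e j) = j.1 • e j := Module.End.mem_eigenspace_iff.1 (b j.1 j.2).2
  have hj0 : e j ≠ 0 := ho.ne_zero j
  have := hs.conj_eigenvalue_eq_self (Module.End.hasEigenvalue_of_hasEigenvector
    ⟨Module.End.mem_eigenspace_iff.2 hj, hj0⟩)
  change S (e j) = _ • e j
  rw [Complex.conj_eq_iff_re.1 this]
  exact hj

/-- A positive semidefinite matrix of finite trace has a spectral decomposition. -/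
theorem nonempty_spectralDecomposition {T : Matrix ι ι ℂ} (hT : T.PosSemidef)
    (hs : Summable fun i => T i i) : Nonempty (SpectralDecomposition T) := by
  classical
  obtain ⟨S, hc, hS⟩ := exists_isCompactOperator_inner_single hT hs
  have hsym := isSymmetric_of_isHermitian hT.1 hS
  obtain ⟨J, b, q, hb⟩ := exists_hilbertBasis_eigenvectors hc hsym
  refine ⟨⟨J, b, q, fun j => ?_, fun k l => ?_⟩⟩
  · have := re_inner_apply_self_nonneg hT hS (b j)
    rw [hb, inner_smul_right, inner_self_eq_norm_sq_to_K, b.orthonormal.1 j] at this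
    simpa using this
  · have h := b.hasSum_inner_mul_inner (lp.single 2 k (1 : ℂ)) (S (lp.single 2 l 1))
    rw [lp.inner_single_left, hS] at h
    have e : ∀ j, inner ℂ (b j) (S (lp.single 2 l 1)) = (q j : ℂ) * star (b j l) := by
      intro j
      rw [← hsym.apply_clm, hb, inner_smul_left, lp.inner_single_right]
      simp
    simp only [e, lp.inner_single_left] at h
    simpa [mul_left_comm] using h

end SpectralTheorem

/-! ### Positive semidefinite matrices: finite reductions, link products, `K ≤ tr K · 1` -/

section Positivity

variable {ι κ R : Type}

/-- Hermiticity and positivity each involve finitely many indices at a time. The submatrix index `μ`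
may be larger than `u`, which allows product-shaped index sets to be used. -/
theorem posSemidef_of_forall_finset {T : Matrix ι ι ℂ}
    (h : ∀ u : Finset ι, ∃ (μ : Type) (e : μ → ι), e.Injective ∧ (u : Set ι) ⊆ Set.range e ∧
      (T.submatrix e e).PosSemidef) : T.PosSemidef := by
  classical
  rw [posSemidef_iff_finset]
  constructor
  · ext i j
    obtain ⟨μ, e, -, hu, hT⟩ := h {i, j}
    obtain ⟨a, rfl⟩ := hu (show i ∈ (({i, j} : Finset ι) : Set ι) by simp)
    obtain ⟨b, rfl⟩ := hu (show j ∈ ((({e a, j} : Finset ι)) : Set ι) by simp)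
    exact hT.1.apply a b
  · intro u f
    obtain ⟨μ, e, he, hu, hT⟩ := h u
    have := (posSemidef_iff_finset.1 hT).2 (u.preimage e he.injOn) (f ∘ e)
    refine this.trans_eq ?_
    have h₀ : ∀ g : ι → ℂ, ∑ a ∈ u.preimage e he.injOn, g (e a) = ∑ i ∈ u, g i := fun g =>
      Finset.sum_preimage e u he.injOn g fun i hi hi' => absurd (hu hi) hi'
    rw [← h₀]
    exact Finset.sum_congr rfl fun a _ => h₀ fun j => star (f (e a)) * T (e a) j * f j

open scoped MatrixOrder Matrix.Norms.L2Operator in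
theorem exists_conjTranspose_mul_self {n : Type} [Fintype n] {T : Matrix n n ℂ}
    (hT : T.PosSemidef) : ∃ B : Matrix n n ℂ, ∀ i j, T i j = ∑ k, star (B k i) * B k j := by
  classical
  obtain ⟨B, hB⟩ := CStarAlgebra.nonneg_iff_eq_star_mul_self.1 hT.nonneg
  exact ⟨B, fun i j => by rw [hB]; rfl⟩

/-- The link product of positive semidefinite matrices is positive semidefinite. -/
theorem posSemidef_link {r a x : Type} [Fintype r] [Fintype a] [Fintype x]
    {T : Matrix (r × a) (r × a) ℂ} {K : Matrix (a × x) (a × x) ℂ} (hT : T.PosSemidef)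
    (hK : K.PosSemidef) : (Matrix.of fun p q : r × x =>
      ∑ i, ∑ j, T (p.1, i) (q.1, j) * K (i, p.2) (j, q.2)).PosSemidef := by
  obtain ⟨B, hB⟩ := exists_conjTranspose_mul_self hT
  obtain ⟨C, hC⟩ := exists_conjTranspose_mul_self hK
  -- Contracting the factors of `T = B*B` and `K = C*C` over the shared index exhibits the link
  -- product as `G*G`.
  let G : Matrix ((r × a) × (a × x)) (r × x) ℂ :=
    Matrix.of fun k p => ∑ i, B k.1 (p.1, i) * C k.2 (i, p.2)
  convert Matrix.posSemidef_conjTranspose_mul_self G using 1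
  ext p q
  have h : ∀ i j, T (p.1, i) (q.1, j) * K (i, p.2) (j, q.2) = ∑ k : (r × a) × (a × x),
      star (B k.1 (p.1, i) * C k.2 (i, p.2)) * (B k.1 (q.1, j) * C k.2 (j, q.2)) := by
    intro i j
    rw [hB, hC, Finset.sum_mul_sum, ← Finset.sum_product', Finset.univ_product_univ]
    refine Finset.sum_congr rfl fun k _ => ?_
    rw [star_mul']
    ring
  simp only [Matrix.of_apply, Matrix.mul_apply, Matrix.conjTranspose_apply, h, G, star_sum,
    Finset.sum_mul_sum]
  rw [Finset.sum_comm]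
  refine (Finset.sum_congr rfl fun i _ => Finset.sum_comm).trans ?_
  rw [Finset.sum_comm]
  refine Finset.sum_congr rfl fun k _ => Finset.sum_comm

/-- With `K = C*C`, Cauchy–Schwarz for each row of `C` bounds `⟨f|K|f⟩` by `‖f‖²` times the sum of
squares of the entries of `C`, which is `tr K`. -/
theorem posSemidef_trace_sub {n : Type} [Fintype n] [DecidableEq n] {K : Matrix n n ℂ}
    (hK : K.PosSemidef) : (K.trace • (1 : Matrix n n ℂ) - K).PosSemidef := by
  obtain ⟨C, hC⟩ := exists_conjTranspose_mul_self hK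
  have htr : K.trace = ((∑ k, ∑ i, ‖C k i‖ ^ 2 : ℝ) : ℂ) := by
    rw [Finset.sum_comm, Complex.ofReal_sum]
    refine Finset.sum_congr rfl fun i _ => ?_
    rw [Matrix.diag_apply, hC, Complex.ofReal_sum]
    refine Finset.sum_congr rfl fun k _ => ?_
    rw [Complex.star_def, mul_comm, Complex.mul_conj, Complex.normSq_eq_norm_sq]
  rw [posSemidef_iff_finset]
  refine ⟨?_, fun s f => ?_⟩
  · refine Matrix.IsHermitian.sub ?_ hK.1
    rw [htr]
    ext i j
    by_cases h : i = j
    · simp [h]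
    · simp [h, Ne.symm h]
  · have e : ∑ i ∈ s, ∑ j ∈ s, star (f i) * (K.trace • (1 : Matrix n n ℂ) - K) i j * f j
        = (((∑ k, ∑ i, ‖C k i‖ ^ 2) * (∑ i ∈ s, ‖f i‖ ^ 2)
          - ∑ k, ‖∑ j ∈ s, C k j * f j‖ ^ 2 : ℝ) : ℂ) := by
      simp only [Matrix.sub_apply, mul_sub, sub_mul, Finset.sum_sub_distrib, Complex.ofReal_sub]
      congr 1
      · rw [Complex.ofReal_mul, ← htr, Complex.ofReal_sum, Finset.mul_sum]
        refine Finset.sum_congr rfl fun i hi => ?_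
        rw [Finset.sum_eq_single i]
        · rw [Matrix.smul_apply, Matrix.one_apply_eq, smul_eq_mul, mul_one, mul_right_comm,
            Complex.star_def, ← Complex.normSq_eq_conj_mul_self, Complex.normSq_eq_norm_sq, mul_comm]
        · intro j _ hj
          rw [Matrix.smul_apply, Matrix.one_apply_ne hj.symm]
          simp
        · exact fun h => absurd hi h
      · rw [Complex.ofReal_sum]
        have hk : ∀ k, ((‖∑ j ∈ s, C k j * f j‖ ^ 2 : ℝ) : ℂ)
            = ∑ i ∈ s, ∑ j ∈ s, star (f i) * (star (C k i) * C k j) * f j := by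
          intro k
          rw [← Complex.normSq_eq_norm_sq, Complex.normSq_eq_conj_mul_self, map_sum,
            Finset.sum_mul_sum]
          refine Finset.sum_congr rfl fun i _ => Finset.sum_congr rfl fun j _ => ?_
          rw [map_mul]
          simp only [Complex.star_def]
          ring
        simp only [hk, hC, Finset.mul_sum, Finset.sum_mul]
        refine (Finset.sum_congr rfl fun i _ => Finset.sum_comm).trans ?_
        rw [Finset.sum_comm]
    rw [e, Complex.zero_le_real, sub_nonneg, Finset.sum_mul]
    refine Finset.sum_le_sum fun k _ => ?_
    calc ‖∑ j ∈ s, C k j * f j‖ ^ 2 ≤ (∑ j ∈ s, ‖C k j‖ * ‖f j‖) ^ 2 := by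
          refine pow_le_pow_left₀ (norm_nonneg _) ((norm_sum_le _ _).trans_eq ?_) 2
          simp only [norm_mul]
      _ ≤ (∑ j ∈ s, ‖C k j‖ ^ 2) * ∑ j ∈ s, ‖f j‖ ^ 2 := Finset.sum_mul_sq_le_sq_mul_sq _ _ _
      _ ≤ (∑ j, ‖C k j‖ ^ 2) * ∑ j ∈ s, ‖f j‖ ^ 2 := by
          refine mul_le_mul_of_nonneg_right ?_ (Finset.sum_nonneg fun _ _ => sq_nonneg _)
          exact Finset.sum_le_sum_of_subset_of_nonneg (Finset.subset_univ _)
            fun _ _ _ => sq_nonneg _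

theorem hasSum_prod_of_nonneg_complex {f : ι × κ → ℂ} {g : ι → ℂ} {a : ℂ} (hf : ∀ x, 0 ≤ f x)
    (h : ∀ i, HasSum (fun j => f (i, j)) (g i)) (hg : HasSum g a) : HasSum f a := by
  have hfr : ∀ x, f x = ((f x).re : ℂ) := fun x =>
    Complex.eq_re_of_ofReal_le (r := 0) (by simpa using hf x)
  have h₁ : HasSum (fun x => (f x).re) a.re :=
    hasSum_prod_of_nonneg (fun x => (Complex.nonneg_iff.1 (hf x)).1)
      (fun i => Complex.hasSum_re (h i)) (Complex.hasSum_re hg)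
  have h₂ : HasSum f (a.re : ℂ) := (Complex.hasSum_ofReal.2 h₁).congr_fun hfr
  rwa [hg.unique (h₂.prod_fiberwise h)]

theorem posSemidef_of_hasSum {T : κ → Matrix ι ι ℂ} {S : Matrix ι ι ℂ} (hT : ∀ k, (T k).PosSemidef)
    (h : ∀ i j, HasSum (fun k => T k i j) (S i j)) : S.PosSemidef := by
  rw [posSemidef_iff_finset]
  refine ⟨?_, fun s f => ?_⟩
  · ext i j
    exact (h j i).star.unique ((h i j).congr_fun fun k => (hT k).1.apply i j)
  · have := hasSum_sum (s := s) fun i _ => hasSum_sum (s := s) fun j _ =>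
      ((h i j).mul_left (star (f i))).mul_right (f j)
    exact this.nonneg fun k => (posSemidef_iff_finset.1 (hT k)).2 s f

end Positivity

/-! ### Trace-class blocks of an operator on a composite system -/

section TraceClass

variable {ι κ R : Type}

theorem isTraceClass_of_posSemidef {T : Matrix ι ι ℂ} (hT : T.PosSemidef)
    (hs : Summable fun i => T i i) : IsTraceClass T := Submodule.subset_span ⟨hT, hs⟩

theorem IsTraceClass.summable {T : Matrix ι ι ℂ} (hT : IsTraceClass T) :
    Summable fun i => T i i := by
  induction hT using Submodule.span_induction with
  | mem T h => exact h.2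
  | zero => exact summable_zero
  | add S T _ _ h₁ h₂ => exact h₁.add h₂
  | smul c T _ h => exact h.mul_left c

/-- The axioms of a channel apply to trace-class operators only, whereas an off-diagonal block is
not positive. Polarization writes it as a combination of the four operators `P c`, `c ∈ {±1, ±i}`;
each `P c` compresses `T` along `f ↦ |r⟩ ⊗ f + c |s⟩ ⊗ f` and so is positive. -/
theorem isTraceClass_block {T : Matrix (R × ι) (R × ι) ℂ} (hT : T.PosSemidef)
    (hs : Summable fun x => T x x) (r s : R) :
    IsTraceClass (T.submatrix (Prod.mk r) (Prod.mk s)) := by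
  let P : ℂ → Matrix ι ι ℂ := fun c => Matrix.of fun i j => T (r, i) (r, j) + c * T (r, i) (s, j)
    + star c * T (s, i) (r, j) + star c * c * T (s, i) (s, j)
  have hdiag : ∀ t : R, Summable fun i => T (t, i) (t, i) := fun t =>
    hs.comp_injective (i := Prod.mk t) (Prod.mk_right_injective t)
  have hre : ∀ t : R, Summable fun i => (T (t, i) (t, i)).re := fun t =>
    (Complex.hasSum_re (hdiag t).hasSum).summable
  have hoff : ∀ t t' : R, Summable fun i => T (t, i) (t', i) := by
    intro t t'
    refine .of_norm_bounded ((hre t).add (hre t')) fun i => ?_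
    have h := norm_apply_sq_le hT (t, i) (t', i)
    have h₁ := re_apply_self_nonneg hT (t, i)
    have h₂ := re_apply_self_nonneg hT (t', i)
    refine abs_le_of_sq_le_sq' ?_ (by positivity) |>.2
    nlinarith
  have hP : ∀ c, IsTraceClass (P c) := by
    intro c
    refine isTraceClass_of_posSemidef ?_ ?_
    · rw [posSemidef_iff_finset]
      constructor
      · ext i j
        simp only [P, Matrix.conjTranspose_apply, Matrix.of_apply, star_add, star_mul', star_star,
          hT.1.apply]
        ring
      · intro u f
        have h := (posSemidef_iff_finset.1 (hT.submatrix fun x : Fin 2 × ι => (![r, s] x.1, x.2))).2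
          (Finset.univ ×ˢ u) (fun x => ![1, c] x.1 * f x.2)
        refine h.trans_eq ?_
        simp only [Finset.sum_product, Fin.sum_univ_two, Matrix.submatrix_apply,
          Matrix.cons_val_zero, Matrix.cons_val_one, ← Finset.sum_add_distrib, P, Matrix.of_apply]
        refine Finset.sum_congr rfl fun i _ => Finset.sum_congr rfl fun j _ => ?_
        simp only [star_mul', star_one]
        ring
    · exact (((hdiag r).add ((hoff r s).mul_left c)).add ((hoff s r).mul_left (star c))).add
        ((hdiag s).mul_left (star c * c))
  have e : T.submatrix (Prod.mk r) (Prod.mk s) = (4⁻¹ : ℂ) • (P 1) + (-4⁻¹ : ℂ) • P (-1)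
      + (-4⁻¹ * Complex.I) • P Complex.I + (4⁻¹ * Complex.I) • P (-Complex.I) := by
    ext i j
    simp only [P, Matrix.add_apply, Matrix.smul_apply, Matrix.of_apply, Matrix.submatrix_apply,
      smul_eq_mul, Complex.star_def, map_neg, Complex.conj_I, map_one]
    linear_combination ((1 / 2) * T (r, i) (s, j) - (1 / 2) * T (s, i) (r, j)) * Complex.I_mul_I
  rw [e]
  exact Submodule.add_mem _ (Submodule.add_mem _ (Submodule.add_mem _
    (Submodule.smul_mem _ _ (hP _)) (Submodule.smul_mem _ _ (hP _)))
    (Submodule.smul_mem _ _ (hP _))) (Submodule.smul_mem _ _ (hP _))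

/-- The (unnormalized) maximally entangled operator. -/
def entangled (ι : Type) [DecidableEq ι] : Matrix (ι × ι) (ι × ι) ℂ :=
  Matrix.vecMulVec (fun x => if x.1 = x.2 then 1 else 0)
    (star fun x => if x.1 = x.2 then 1 else 0)

theorem entangled_apply [DecidableEq ι] (a b i j : ι) :
    entangled ι (a, i) (b, j) = Matrix.single a b (1 : ℂ) i j := by
  simp only [entangled, Matrix.vecMulVec_apply, Pi.star_apply, Matrix.single_apply, ite_and]
  split_ifs <;> simp

theorem entangled_posSemidef [Fintype ι] [DecidableEq ι] : (entangled ι).PosSemidef :=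
  Matrix.posSemidef_vecMulVec_self_star _

theorem isTraceClass_single [Finite ι] [DecidableEq ι] (a b : ι) :
    IsTraceClass (Matrix.single a b (1 : ℂ)) := by
  have := Fintype.ofFinite ι
  convert isTraceClass_block (entangled_posSemidef (ι := ι)) (hasSum_fintype _).summable a b using 1
  ext i j
  exact (entangled_apply a b i j).symm

end TraceClass

/-! ### Channels, Choi matrices and domination by the completely mixing map -/

section Channels

variable {ι κ R : Type}

theorem tr_add {S T : Matrix ι ι ℂ} (hS : IsTraceClass S) (hT : IsTraceClass T) :
    tr (S + T) = tr S + tr T := hS.summable.tsum_add hT.summable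

theorem tr_smul (c : ℂ) (T : Matrix ι ι ℂ) : tr (c • T) = c * tr T := tsum_mul_left

/-- The reduced operator `tr_ι T` of an operator `T` on `R ⊗ ι`. -/
noncomputable def partialTrace (T : Matrix (R × ι) (R × ι) ℂ) : Matrix R R ℂ :=
  Matrix.of fun r s => tr (T.submatrix (Prod.mk r) (Prod.mk s))

open Classical in
/-- The operator `ω ⊗ 1`. -/
noncomputable def tensorOne (κ : Type) (ω : Matrix R R ℂ) : Matrix (R × κ) (R × κ) ℂ :=
  Matrix.of fun x y => ω x.1 y.1 * (1 : Matrix κ κ ℂ) x.2 y.2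

theorem idTensor_replacer (T : Matrix (R × ι) (R × ι) ℂ) :
    idTensor R (replacer ι κ) T = tensorOne κ (partialTrace T) := rfl

theorem tensorOne_posSemidef [Finite R] [Finite κ] {ω : Matrix R R ℂ} (hω : ω.PosSemidef) :
    (tensorOne κ ω).PosSemidef := by
  classical
  exact hω.kronecker Matrix.PosSemidef.one

theorem hasSum_partialTrace_apply {T : Matrix (R × ι) (R × ι) ℂ} (hT : T.PosSemidef)
    (hs : Summable fun x => T x x) (r s : R) :
    HasSum (fun i => T (r, i) (s, i)) (partialTrace T r s) :=
  (isTraceClass_block hT hs r s).summable.hasSum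

theorem partialTrace_posSemidef {T : Matrix (R × ι) (R × ι) ℂ} (hT : T.PosSemidef)
    (hs : Summable fun x => T x x) : (partialTrace T).PosSemidef :=
  posSemidef_of_hasSum (fun i => hT.submatrix fun r => (r, i)) (hasSum_partialTrace_apply hT hs)

theorem IsState.partialTrace {ρ : Matrix (R × ι) (R × ι) ℂ} (hρ : IsState ρ) :
    IsState (partialTrace ρ) :=
  ⟨partialTrace_posSemidef hρ.1 hρ.2.summable,
    hρ.2.prod_fiberwise fun r => hasSum_partialTrace_apply hρ.1 hρ.2.summable r r⟩

theorem Channel.map_zero (N : Channel ι κ) : N.toFun 0 = 0 := by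
  have := N.map_smul 0 0 (Submodule.zero_mem _)
  simpa using this

theorem Channel.map_sum {α : Type*} (N : Channel ι κ) (s : Finset α) (c : α → ℂ)
    (T : α → Matrix ι ι ℂ) (hT : ∀ a, IsTraceClass (T a)) :
    N.toFun (∑ a ∈ s, c a • T a) = ∑ a ∈ s, c a • N.toFun (T a) := by
  classical
  induction s using Finset.induction_on with
  | empty => simp [N.map_zero]
  | insert a s ha ih =>
    rw [Finset.sum_insert ha, Finset.sum_insert ha, N.map_add, ih, N.map_smul _ _ (hT a)]
    · exact Submodule.smul_mem _ _ (hT a)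
    · exact Submodule.sum_mem _ fun b _ => Submodule.smul_mem _ _ (hT b)

/-- A finite set of indices meets only finitely many levels of the reference, so complete positivity
for the references `Fin n` suffices. -/
theorem Channel.idTensor_posSemidef (N : Channel ι κ) {T : Matrix (R × ι) (R × ι) ℂ}
    (hT : T.PosSemidef) (hs : Summable fun x => T x x) : (idTensor R N.toFun T).PosSemidef := by
  classical
  refine posSemidef_of_forall_finset fun u => ?_
  let s := u.image Prod.fst
  let g : Fin s.card → R := fun k => (s.equivFin.symm k : R)
  have hg : g.Injective := Subtype.val_injective.comp s.equivFin.symm.injective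
  refine ⟨Fin s.card × κ, Prod.map g id, hg.prodMap Function.injective_id, ?_, ?_⟩
  · intro x hx
    have hx' : x.1 ∈ s := Finset.mem_image_of_mem _ hx
    exact ⟨(s.equivFin ⟨x.1, hx'⟩, x.2), by simp [g]⟩
  · have h := hT.submatrix (Prod.map g (id : ι → ι))
    exact N.completely_positive s.card (T.submatrix (Prod.map g id) (Prod.map g id)) h
      (isTraceClass_of_posSemidef h (hs.comp_injective (hg.prodMap Function.injective_id)))

theorem IsState.idTensor {ρ : Matrix (R × ι) (R × ι) ℂ} (hρ : IsState ρ) (N : Channel ι κ) :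
    IsState (idTensor R N.toFun ρ) := by
  have hpos := N.idTensor_posSemidef hρ.1 hρ.2.summable
  exact ⟨hpos, hasSum_prod_of_nonneg_complex (fun x => hpos.diag_nonneg)
    (fun r => N.trace_preserving _ (isTraceClass_block hρ.1 hρ.2.summable r r))
    hρ.partialTrace.2⟩

theorem partialTrace_idTensor (N : Channel ι κ) {T : Matrix (R × ι) (R × ι) ℂ}
    (hT : T.PosSemidef) (hs : Summable fun x => T x x) :
    partialTrace (idTensor R N.toFun T) = partialTrace T := by
  ext r s
  exact (N.trace_preserving _ (isTraceClass_block hT hs r s)).tsum_eq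

/-- The Choi matrix `∑ |a⟩⟨b| ⊗ N(|a⟩⟨b|)`. -/
noncomputable def Channel.choi [DecidableEq ι] (N : Channel ι κ) : Matrix (ι × κ) (ι × κ) ℂ :=
  Matrix.of fun x y => N.toFun (Matrix.single x.1 y.1 1) x.2 y.2

theorem Channel.choi_posSemidef [Fintype ι] [DecidableEq ι] (N : Channel ι κ) :
    N.choi.PosSemidef := by
  have h : N.choi = QuantumChannel.idTensor ι N.toFun (entangled ι) := by
    ext x y
    have : (entangled ι).submatrix (Prod.mk x.1) (Prod.mk y.1) = Matrix.single x.1 y.1 1 := by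
      ext i j
      exact entangled_apply _ _ _ _
    simp only [QuantumChannel.idTensor, Matrix.of_apply, this, Channel.choi]
  rw [h]
  exact N.idTensor_posSemidef entangled_posSemidef (hasSum_fintype _).summable

/-- Each `N(|i⟩⟨i|)` has trace one, and truncating the output to `t` only drops nonnegative diagonal
entries. -/
theorem Channel.sum_choi_le [Fintype ι] [DecidableEq ι] (N : Channel ι κ) (t : Finset κ) :
    ∑ i : ι, ∑ x ∈ t, (N.choi (i, x) (i, x)).re ≤ Fintype.card ι := by
  have h : ∀ i : ι, ∑ x ∈ t, (N.choi (i, x) (i, x)).re ≤ 1 := by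
    intro i
    have h₁ := Complex.hasSum_re (N.trace_preserving _ (isTraceClass_single i i))
    have h₂ : tr (Matrix.single i i (1 : ℂ)) = 1 := by
      rw [tr, tsum_fintype]
      exact Matrix.trace_single_eq_same i 1
    rw [h₂, Complex.one_re] at h₁
    exact sum_le_hasSum t (fun x _ => re_apply_self_nonneg N.choi_posSemidef (i, x)) h₁
  refine (Finset.sum_le_sum fun i _ => h i).trans_eq ?_
  simp

/-- A channel with finite-dimensional input is dominated by the completely mixing map, in the
completely positive order. -/
theorem Channel.posSemidef_card_smul_sub [Fintype ι] (N : Channel ι κ)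
    {T : Matrix (R × ι) (R × ι) ℂ} (hT : T.PosSemidef) :
    (((Fintype.card ι : ℝ) : ℂ) • QuantumChannel.idTensor R (replacer ι κ) T
      - QuantumChannel.idTensor R N.toFun T).PosSemidef := by
  classical
  refine posSemidef_of_forall_finset fun u => ?_
  let s := u.image Prod.fst
  let t := u.image Prod.snd
  refine ⟨s × t, Prod.map (↑) (↑), Subtype.val_injective.prodMap Subtype.val_injective, ?_, ?_⟩
  · intro x hx
    exact ⟨(⟨x.1, Finset.mem_image_of_mem _ hx⟩, ⟨x.2, Finset.mem_image_of_mem _ hx⟩), rfl⟩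
  let e : ι × t → ι × κ := Prod.map id (↑)
  have hJ : (N.choi.submatrix e e).PosSemidef := N.choi_posSemidef.submatrix e
  have htr : (N.choi.submatrix e e).trace
      = ((∑ i : ι, ∑ x ∈ t, (N.choi (i, x) (i, x)).re : ℝ) : ℂ) := by
    rw [Matrix.trace, Fintype.sum_prod_type, Complex.ofReal_sum]
    refine Finset.sum_congr rfl fun i _ => ?_
    rw [Complex.ofReal_sum, ← Finset.sum_coe_sort t]
    exact Finset.sum_congr rfl fun x _ => apply_self_eq_ofReal N.choi_posSemidef _
  -- For the truncated Choi matrix `J` and `d = |ι|`, this is the sum of `tr J · 1 - J` and `(d - tr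
  -- J) · 1`. Linking `T` with it reproduces `d ℛ(T) - N(T)` on the chosen finite block.
  have hK : (((Fintype.card ι : ℝ) : ℂ) • (1 : Matrix (ι × t) (ι × t) ℂ)
      - N.choi.submatrix e e).PosSemidef := by
    have h₁ := posSemidef_trace_sub hJ
    have h₂ : (0 : ℂ) ≤ (((Fintype.card ι : ℝ) - ∑ i : ι, ∑ x ∈ t, (N.choi (i, x) (i, x)).re : ℝ)
        : ℂ) := by
      rw [Complex.zero_le_real, sub_nonneg]
      exact N.sum_choi_le t
    convert h₁.add ((Matrix.PosSemidef.one (n := ι × t) (R := ℂ)).smul h₂) using 1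
    rw [htr, Complex.ofReal_sub, sub_smul]
    abel
  convert posSemidef_link (hT.submatrix (Prod.map (fun r : s => (r : R)) (id : ι → ι))) hK using 1
  ext x y
  have hN : QuantumChannel.idTensor R N.toFun T (Prod.map (↑) (↑) x) (Prod.map (↑) (↑) y)
      = ∑ i, ∑ j, T (x.1, i) (y.1, j) * N.choi (i, x.2) (j, y.2) := by
    have h := Matrix.matrix_eq_sum_single (T.submatrix (Prod.mk (x.1 : R)) (Prod.mk (y.1 : R)))
    have h' : T.submatrix (Prod.mk (x.1 : R)) (Prod.mk (y.1 : R))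
        = ∑ k : ι × ι, T (x.1, k.1) (y.1, k.2) • Matrix.single k.1 k.2 (1 : ℂ) := by
      rw [h, Fintype.sum_prod_type]
      simp
    change N.toFun (T.submatrix (Prod.mk (x.1 : R)) (Prod.mk (y.1 : R))) x.2 y.2 = _
    rw [h', N.map_sum Finset.univ (fun k : ι × ι => T (x.1, k.1) (y.1, k.2))
      (fun k => Matrix.single k.1 k.2 1) fun k => isTraceClass_single k.1 k.2, Fintype.sum_prod_type,
      Matrix.sum_apply]
    refine Finset.sum_congr rfl fun i _ => ?_
    rw [Matrix.sum_apply]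
    rfl
  have hR : QuantumChannel.idTensor R (replacer ι κ) T (Prod.map (↑) (↑) x) (Prod.map (↑) (↑) y)
      = ∑ i, ∑ j, T (x.1, i) (y.1, j) * (1 : Matrix (ι × t) (ι × t) ℂ) (i, x.2) (j, y.2) := by
    rw [idTensor_replacer]
    simp only [tensorOne, partialTrace, tr, tsum_fintype, Matrix.of_apply, Matrix.submatrix_apply,
      Finset.sum_mul, Prod.map]
    refine Finset.sum_congr rfl fun i _ => ?_
    rw [Finset.sum_eq_single i]
    · by_cases h : x.2 = y.2
      · rw [h, Matrix.one_apply_eq, Matrix.one_apply_eq]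
      · have h' : (x.2 : κ) ≠ y.2 := fun hxy => h (Subtype.ext hxy)
        have h'' : (i, x.2) ≠ (i, y.2) := fun hxy => h (Prod.mk.inj hxy).2
        rw [Matrix.one_apply_ne h', Matrix.one_apply_ne h'']
    · intro j _ hj
      simp [hj.symm]
    · simp
  rw [Matrix.submatrix_apply, Matrix.sub_apply, Matrix.smul_apply, hN, hR]
  simp only [smul_eq_mul, Finset.mul_sum, ← Finset.sum_sub_distrib, Matrix.of_apply,
    Matrix.submatrix_apply, Matrix.sub_apply, Matrix.smul_apply, mul_sub, e, Prod.map, id]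
  refine Finset.sum_congr rfl fun i _ => Finset.sum_congr rfl fun j _ => ?_
  ring

/-- The identity channel. -/
noncomputable def idChannel (κ : Type) : Channel κ κ where
  toFun T := T
  map_add _ _ _ _ := rfl
  map_smul _ _ _ := rfl
  completely_positive _ _ hT _ := hT
  trace_preserving _ hT := hT.summable.hasSum

/-- The channel that prepares the maximally mixed state of a finite-dimensional system. -/
noncomputable def mixingChannel (ι κ : Type) [Fintype κ] [Nonempty κ] : Channel ι κ where
  toFun T := (((Fintype.card κ : ℝ)⁻¹ : ℝ) : ℂ) • replacer ι κ T
  map_add S T hS hT := by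
    simp only [replacer, tr_add hS hT, add_smul, smul_add]
  map_smul c T _ := by
    simp only [replacer, tr_smul, mul_smul]
    rw [smul_comm]
  completely_positive n T hT hT' := by
    have h : (0 : ℂ) ≤ (((Fintype.card κ : ℝ)⁻¹ : ℝ) : ℂ) := by
      rw [Complex.zero_le_real]
      positivity
    exact (tensorOne_posSemidef (κ := κ) (partialTrace_posSemidef hT hT'.summable)).smul h
  trace_preserving T _ := by
    convert hasSum_fintype _ using 1
    have h : ((Fintype.card κ : ℝ) : ℂ) ≠ 0 := by simp
    simp only [Matrix.smul_apply, replacer, Matrix.one_apply_eq, smul_eq_mul, mul_one,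
      Finset.sum_const, Finset.card_univ, nsmul_eq_mul, Complex.ofReal_inv]
    rw [← mul_assoc, ← Complex.ofReal_natCast, mul_inv_cancel₀ h, one_mul]

/-- Tracing out `B'` and then `A'` is the full trace; for infinite systems this rests on the
summability of the diagonal. -/
theorem tensorMap_replacer_mixing {A' B' A B : Type} [Fintype B] [Nonempty B]
    {T : Matrix (A' × B') (A' × B') ℂ} (hT : IsTraceClass T) :
    tensorMap (replacer A' A) (mixingChannel B' B).toFun T
      = (((Fintype.card B : ℝ)⁻¹ : ℝ) : ℂ) • replacer (A' × B') (A × B) T := by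
  classical
  ext x y
  have h : ∑' i : A', (((Fintype.card B : ℝ)⁻¹ : ℝ) : ℂ) *
      (tr (T.submatrix (Prod.mk i) (Prod.mk i)) * (1 : Matrix B B ℂ) x.2 y.2)
      = (((Fintype.card B : ℝ)⁻¹ : ℝ) : ℂ) * (tr T * (1 : Matrix B B ℂ) x.2 y.2) := by
    rw [tsum_mul_left, tsum_mul_right, tr, hT.summable.tsum_prod]
    rfl
  have h' : tensorMap (replacer A' A) (mixingChannel B' B).toFun T x y
      = (∑' i : A', (((Fintype.card B : ℝ)⁻¹ : ℝ) : ℂ) *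
      (tr (T.submatrix (Prod.mk i) (Prod.mk i)) * (1 : Matrix B B ℂ) x.2 y.2))
        * (1 : Matrix A A ℂ) x.1 y.1 := by
    simp only [tensorMap, tensorId, idTensor, mixingChannel, replacer, tr, Matrix.of_apply,
      Matrix.smul_apply, Matrix.submatrix_apply, smul_eq_mul, Matrix.one_apply]
  rw [h', h]
  simp only [replacer, Matrix.smul_apply, smul_eq_mul, Matrix.one_apply, Prod.ext_iff]
  by_cases h₁ : x.1 = y.1 <;> by_cases h₂ : x.2 = y.2 <;> simp [h₁, h₂]

end Channels

/-! ### Spectral decomposition of `ω ⊗ 1` -/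

section TensorBasis

variable {R κ : Type}

open Classical in
/-- The vector `v ⊗ |x⟩`. -/
noncomputable def tensorVec (v : lp (fun _ : R => ℂ) 2) (x : κ) : lp (fun _ : R × κ => ℂ) 2 :=
  ⟨fun y => if y.2 = x then v y.1 else 0, by
    change Memℓp _ _
    rw [memℓp_gen_iff (by norm_num)]
    simp only [ENNReal.toReal_ofNat, Real.rpow_ofNat]
    refine ((Prod.mk_left_injective x).hasSum_iff (f := fun y : R × κ =>
      ‖if y.2 = x then v y.1 else 0‖ ^ 2) (a := ‖v‖ ^ 2) ?_).1 ?_ |>.summable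
    · rintro ⟨r, y⟩ hy
      have : y ≠ x := fun h => hy ⟨r, by rw [h]⟩
      simp [this]
    · simpa [Function.comp_def] using hasSum_norm_sq_apply v⟩

open Classical in
theorem tensorVec_apply (v : lp (fun _ : R => ℂ) 2) (x : κ) (y : R × κ) :
    tensorVec v x y = if y.2 = x then v y.1 else 0 := rfl

/-- The vector `(1 ⊗ ⟨x|) u`. -/
noncomputable def sliceVec (u : lp (fun _ : R × κ => ℂ) 2) (x : κ) : lp (fun _ : R => ℂ) 2 :=
  ⟨fun r => u (r, x), by
    change Memℓp _ _
    rw [memℓp_gen_iff (by norm_num)]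
    simp only [ENNReal.toReal_ofNat, Real.rpow_ofNat]
    exact (hasSum_norm_sq_apply u).summable.comp_injective (Prod.mk_left_injective x)⟩

/-- Slicing is the adjoint of tensoring with a basis vector. It reduces both orthonormality and
completeness of the product basis to those of the given basis. -/
theorem inner_tensorVec_left (v : lp (fun _ : R => ℂ) 2) (x : κ) (u : lp (fun _ : R × κ => ℂ) 2) :
    inner ℂ (tensorVec v x) u = inner ℂ v (sliceVec u x) := by
  have h := lp.hasSum_inner (𝕜 := ℂ) (tensorVec v x) u
  rw [← (Prod.mk_left_injective x).hasSum_iff] at h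
  · refine h.unique ((lp.hasSum_inner (𝕜 := ℂ) v (sliceVec u x)).congr_fun fun r => ?_)
    simp only [Function.comp_def, tensorVec_apply, if_true]
    rfl
  · rintro ⟨r, y⟩ hy
    have : y ≠ x := fun h => hy ⟨r, by rw [h]⟩
    simp [tensorVec_apply, this]

open Classical in
theorem sliceVec_tensorVec (v : lp (fun _ : R => ℂ) 2) (x y : κ) :
    sliceVec (tensorVec v x) y = if y = x then v else 0 := by
  ext r
  change (if y = x then v r else 0) = _
  split_ifs <;> rfl

/-- The orthonormal basis `(eⱼ ⊗ |x⟩)`. -/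
noncomputable def tensorBasis {J : Type} (b : HilbertBasis J ℂ (lp (fun _ : R => ℂ) 2)) (κ : Type) :
    HilbertBasis (J × κ) ℂ (lp (fun _ : R × κ => ℂ) 2) :=
  HilbertBasis.mkOfOrthogonalEqBot (v := fun j => tensorVec (b j.1) j.2)
    (by
      classical
      rw [orthonormal_iff_ite]
      rintro ⟨j, x⟩ ⟨k, y⟩
      rw [inner_tensorVec_left, sliceVec_tensorVec]
      by_cases hx : x = y
      · simp [hx, orthonormal_iff_ite.1 b.orthonormal]
      · simp [hx])
    (by
      rw [eq_bot_iff]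
      intro u hu
      have h : ∀ x, sliceVec u x = 0 := by
        intro x
        refine b.repr.injective ?_
        ext j
        rw [b.repr_apply_apply, ← inner_tensorVec_left, map_zero]
        exact (Submodule.mem_orthogonal _ _).1 hu _ (Submodule.subset_span ⟨(j, x), rfl⟩)
      rw [Submodule.mem_bot]
      ext y
      exact congrFun (congrArg Subtype.val (h y.2)) y.1)

theorem tensorBasis_apply {J : Type} (b : HilbertBasis J ℂ (lp (fun _ : R => ℂ) 2)) (j : J × κ) :
    tensorBasis b κ j = tensorVec (b j.1) j.2 := by
  rw [tensorBasis, HilbertBasis.coe_mkOfOrthogonalEqBot]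

/-- The spectral decomposition of `ω ⊗ 1`. -/
noncomputable def SpectralDecomposition.tensorOne {ω : Matrix R R ℂ} (P : SpectralDecomposition ω)
    (κ : Type) : SpectralDecomposition (tensorOne κ ω) where
  index := P.index × κ
  basis := tensorBasis P.basis κ
  eigenvalue j := P.eigenvalue j.1
  eigenvalue_nonneg j := P.eigenvalue_nonneg j.1
  hasSum k l := by
    classical
    simp only [tensorBasis_apply, tensorVec_apply]
    rw [← (Prod.mk_left_injective (α := P.index) k.2).hasSum_iff]
    · have e : QuantumChannel.tensorOne κ ω k l = ω k.1 l.1 * (1 : Matrix κ κ ℂ) k.2 l.2 := by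
        simp [QuantumChannel.tensorOne, Matrix.one_apply]
      rw [e]
      refine ((P.hasSum k.1 l.1).mul_right _).congr_fun fun j => ?_
      by_cases hkl : k.2 = l.2
      · have h₁ : (1 : Matrix κ κ ℂ) k.2 l.2 = 1 := by rw [hkl, Matrix.one_apply_eq]
        rw [h₁]
        simp [hkl]
      · simp [hkl, Ne.symm hkl]
    · rintro ⟨j, y⟩ hy
      have : k.2 ≠ y := fun h => hy ⟨j, by rw [h]⟩
      simp [this]

end TensorBasis

/-! ### Bounds on channel divergences -/

section Divergence

variable {ι κ : Type}

/-- The output space may be infinite-dimensional: `ω ⊗ 1` has the eigenvalues of the state `ω`,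
hence is bounded by one, which is all that the domination bound asks of its second argument. -/
theorem channelDivergence_replacer_le_of_posSemidef (N : Channel ι κ) {c : ℝ} (hc : 0 < c)
    (h : ∀ (R : Type) (ρ : Matrix (R × ι) (R × ι) ℂ), IsState ρ →
      ((c : ℂ) • idTensor R (replacer ι κ) ρ - idTensor R N.toFun ρ).PosSemidef) :
    channelDivergence N.toFun (replacer ι κ) ≤ ((Real.logb 2 c : ℝ) : EReal) := by
  refine iSup_le fun R => iSup_le fun _ => iSup_le fun ρ => iSup_le fun hρ => ?_
  have hN := hρ.idTensor N
  have hR := hρ.partialTrace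
  obtain ⟨P⟩ := nonempty_spectralDecomposition hN.1 hN.2.summable
  obtain ⟨Q⟩ := nonempty_spectralDecomposition hR.1 hR.2.summable
  exact relEntropy_le_logb P (Q.tensorOne κ) hN.2 (fun j => Q.eigenvalue_le_one hR.2 j.1) hc
    (h R ρ hρ)

theorem channelDivergence_replacer_le_card_input [Fintype ι] [Nonempty ι] (N : Channel ι κ) :
    channelDivergence N.toFun (replacer ι κ)
      ≤ ((Real.logb 2 (Fintype.card ι : ℝ) : ℝ) : EReal) :=
  channelDivergence_replacer_le_of_posSemidef N (by positivity)
    fun _ _ hρ => N.posSemidef_card_smul_sub hρ.1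

theorem channelDivergence_replacer_le_card_output [Fintype κ] [Nonempty κ] (N : Channel ι κ) :
    channelDivergence N.toFun (replacer ι κ)
      ≤ ((Real.logb 2 (Fintype.card κ : ℝ) : ℝ) : EReal) := by
  refine channelDivergence_replacer_le_of_posSemidef N (by positivity) fun R ρ hρ => ?_
  -- The identity channel of the output system is dominated by `|κ| ℛ`. Applied to `N(ρ)`, this
  -- involves only the reduced state on the reference, which is that of `ρ`.
  have h := (idChannel κ).posSemidef_card_smul_sub (hρ.idTensor N).1
  rw [idTensor_replacer, partialTrace_idTensor N hρ.1 hρ.2.summable] at h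
  exact h

open Classical in
/-- The pure state `|i⟩⟨i|`, with trivial reference system. -/
noncomputable def basisState (i : ι) : Matrix (Unit × ι) (Unit × ι) ℂ :=
  Matrix.diagonal fun x => if x = ((), i) then 1 else 0

open Classical in
theorem basisState_apply (i x y : ι) :
    basisState i ((), x) ((), y) = if x = y ∧ x = i then 1 else 0 := by
  by_cases h : x = y
  · subst h
    by_cases h' : x = i <;> simp [basisState, h']
  · simp [basisState, h]

theorem isState_basisState (i : ι) : IsState (basisState i) := by
  classical
  refine ⟨Matrix.PosSemidef.diagonal fun x => ?_, ?_⟩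
  · dsimp only [Pi.zero_apply]
    split_ifs
    · exact zero_le_one
    · exact le_rfl
  · simp only [basisState, Matrix.diagonal_apply_eq]
    exact hasSum_ite_eq _ _

theorem neg_logb_le_channelDivergence (N : Channel ι κ) (M : Matrix ι ι ℂ → Matrix κ κ ℂ) (i : ι)
    {t : ℝ} (ht : 0 < t)
    (h : HasSum (fun x => idTensor Unit M (basisState i) x x) (t : ℂ)) :
    ((-Real.logb 2 t : ℝ) : EReal) ≤ channelDivergence N.toFun M := by
  refine (neg_logb_le_relEntropy ((isState_basisState i).idTensor N).2 ht h).trans ?_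
  exact le_iSup_of_le Unit (le_iSup_of_le inferInstance
    (le_iSup_of_le (basisState i) (le_iSup_of_le (isState_basisState i) le_rfl)))

theorem neg_logb_card_le_channelDivergence_replacer [Nonempty ι] [Fintype κ] [Nonempty κ]
    (N : Channel ι κ) : ((-Real.logb 2 (Fintype.card κ : ℝ) : ℝ) : EReal)
      ≤ channelDivergence N.toFun (replacer ι κ) := by
  obtain ⟨i⟩ := ‹Nonempty ι›
  refine neg_logb_le_channelDivergence N _ i (by positivity) ?_
  have h : partialTrace (basisState i) () () = 1 := by
    simpa using (hasSum_fintype _).unique (isState_basisState i).partialTrace.2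
  convert hasSum_fintype (β := Unit × κ) _ using 1
  simp [idTensor_replacer, tensorOne, h]

theorem basisState_submatrix {A' B' : Type} (a a' : A') (b : B') [Decidable (a' = a)] :
    ((basisState (a, b)).submatrix (Prod.mk ()) (Prod.mk ())).submatrix (Prod.mk a') (Prod.mk a')
      = if a' = a then (basisState b).submatrix (Prod.mk ()) (Prod.mk ()) else 0 := by
  classical
  ext x y
  by_cases h : a' = a
  · subst h
    have e : (a', x) = (a', y) ∧ (a', x) = (a', b) ↔ x = y ∧ x = b := by simp
    simp only [Matrix.submatrix_apply, if_true, basisState_apply]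
    by_cases hxy : x = y ∧ x = b
    · rw [if_pos (e.2 hxy), if_pos hxy]
    · rw [if_neg (mt e.1 hxy), if_neg hxy]
  · simp [basisState_apply, h]

theorem tensorMap_replacer_basisState {A' B' A B : Type} (M : Channel B' B) (a : A') (b : B')
    (x : A × B) :
    idTensor Unit (tensorMap (replacer A' A) M.toFun) (basisState (a, b)) ((), x) ((), x)
      = idTensor Unit M.toFun (basisState b) ((), x.2) ((), x.2) := by
  classical
  have h : idTensor Unit (tensorMap (replacer A' A) M.toFun) (basisState (a, b)) ((), x) ((), x)
      = (∑' a' : A', M.toFun (((basisState (a, b)).submatrix (Prod.mk ()) (Prod.mk ())).submatrix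
        (Prod.mk a') (Prod.mk a')) x.2 x.2) * (1 : Matrix A A ℂ) x.1 x.1 := by
    simp only [Matrix.one_apply_eq]
    simp only [idTensor, tensorMap, tensorId, replacer, tr, Matrix.of_apply, Matrix.smul_apply,
      Matrix.one_apply_eq, smul_eq_mul, Matrix.submatrix_apply]
  rw [h, Matrix.one_apply_eq, mul_one, tsum_eq_single a]
  · rw [basisState_submatrix, if_pos rfl]
    rfl
  · intro a' ha'
    rw [basisState_submatrix, if_neg ha', M.map_zero, Matrix.zero_apply]

theorem hasSum_unit_prod (f : Unit × κ → ℂ) {a : ℂ} :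
    HasSum (fun y => f ((), y)) a ↔ HasSum f a :=
  (Prod.mk_right_injective ()).hasSum_iff (by
    rintro ⟨⟨⟩, y⟩ h
    exact absurd ⟨y, rfl⟩ h)

/-- On the basis state `(a, b)` the second output is `1 ⊗ M(|b⟩⟨b|)`, whose trace is `|A|` for every
channel `M`. -/
theorem neg_logb_card_le_channelDivergence_tensorMap {A' B' A B : Type} [Nonempty A'] [Nonempty B']
    [Fintype A] [Nonempty A] (N : Channel (A' × B') (A × B)) (M : Channel B' B) :
    ((-Real.logb 2 (Fintype.card A : ℝ) : ℝ) : EReal)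
      ≤ channelDivergence N.toFun (tensorMap (replacer A' A) M.toFun) := by
  classical
  obtain ⟨a⟩ := ‹Nonempty A'›
  obtain ⟨b⟩ := ‹Nonempty B'›
  refine neg_logb_le_channelDivergence N _ (a, b) (by positivity) ?_
  have hM := (isState_basisState b).idTensor M
  have h₁ : HasSum (fun y : B => idTensor Unit M.toFun (basisState b) ((), y) ((), y)) 1 :=
    (hasSum_unit_prod fun x => idTensor Unit M.toFun (basisState b) x x).2 hM.2
  have h₂ : HasSum (fun x : A × B => idTensor Unit M.toFun (basisState b) ((), x.2) ((), x.2))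
      (Fintype.card A : ℂ) := by
    refine hasSum_prod_of_nonneg_complex (fun x => hM.1.diag_nonneg) (fun _ => h₁) ?_
    simpa using hasSum_fintype fun _ : A => (1 : ℂ)
  refine (hasSum_unit_prod fun x =>
    idTensor Unit (tensorMap (replacer A' A) M.toFun) (basisState (a, b)) x x).1 ?_
  exact h₂.congr_fun fun x => tensorMap_replacer_basisState M a b x

theorem channelDivergence_mixing_le {A' B' A B : Type} [Fintype B] [Nonempty B]
    (N : Channel (A' × B') (A × B)) :
    channelDivergence N.toFun (tensorMap (replacer A' A) (mixingChannel B' B).toFun)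
      ≤ channelDivergence N.toFun (replacer (A' × B') (A × B))
        + ((Real.logb 2 (Fintype.card B : ℝ) : ℝ) : EReal) := by
  refine iSup_le fun R => iSup_le fun hR => iSup_le fun ρ => iSup_le fun hρ => ?_
  have e : idTensor R (tensorMap (replacer A' A) (mixingChannel B' B).toFun) ρ
      = (((Fintype.card B : ℝ)⁻¹ : ℝ) : ℂ) • idTensor R (replacer (A' × B') (A × B)) ρ := by
    ext x y
    simp only [idTensor, Matrix.of_apply, Matrix.smul_apply,
      tensorMap_replacer_mixing (isTraceClass_block hρ.1 hρ.2.summable x.1 y.1)]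
  rw [e]
  refine (relEntropy_smul_le (hρ.idTensor N).2 (by positivity)).trans ?_
  rw [Real.logb_inv, neg_neg]
  refine add_le_add ?_ le_rfl
  exact le_iSup_of_le R (le_iSup_of_le hR (le_iSup_of_le ρ (le_iSup_of_le hρ le_rfl)))

end Divergence

/-! ### Logarithms of dimensions -/

section Log

theorem log2_top : log2 ⊤ = ⊤ := if_pos rfl

theorem log2_natCast (n : ℕ) : log2 n = ((Real.logb 2 (n : ℝ) : ℝ) : EReal) := by
  rw [log2, if_neg (ENat.natCast_ne_top n), ENat.toNat_natCast]

/-- Both factors must be nonzero: `⊤ * 0` is not `⊤`, and `Real.logb 2 0 = 0` breaks additivity. -/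
theorem log2_mul_natCast {m : ℕ∞} (hm : m ≠ 0) {n : ℕ} (hn : n ≠ 0) :
    log2 (m * n) = log2 m + log2 n := by
  induction m using ENat.recTopCoe with
  | top => rw [ENat.top_mul (by exact_mod_cast hn), log2_top, log2_natCast, EReal.top_add_coe]
  | coe k =>
    have hk : k ≠ 0 := by exact_mod_cast hm
    rw [← Nat.cast_mul, log2_natCast, log2_natCast, log2_natCast, Nat.cast_mul,
      Real.logb_mul (by exact_mod_cast hk) (by exact_mod_cast hn), EReal.coe_add]

end Log

/-! ### Entropy bounds, with infinite dimensions as trivial cases -/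

section Entropy

variable {ι κ : Type}

theorem neg_log2_card_input_le_entropy [Nonempty ι] (N : Channel ι κ) :
    -log2 (ENat.card ι) ≤ entropy N := by
  rw [entropy, EReal.neg_le_neg_iff]
  cases finite_or_infinite ι
  · have := Fintype.ofFinite ι
    rw [ENat.card_eq_coe_fintype_card, log2_natCast]
    exact channelDivergence_replacer_le_card_input N
  · rw [ENat.card_eq_top_of_infinite, log2_top]
    exact le_top

theorem neg_log2_card_output_le_entropy [Nonempty κ] (N : Channel ι κ) :
    -log2 (ENat.card κ) ≤ entropy N := by
  rw [entropy, EReal.neg_le_neg_iff]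
  cases finite_or_infinite κ
  · have := Fintype.ofFinite κ
    rw [ENat.card_eq_coe_fintype_card, log2_natCast]
    exact channelDivergence_replacer_le_card_output N
  · rw [ENat.card_eq_top_of_infinite, log2_top]
    exact le_top

theorem entropy_le_log2_card [Nonempty ι] [Nonempty κ] (N : Channel ι κ) :
    entropy N ≤ log2 (ENat.card κ) := by
  cases finite_or_infinite κ
  · have := Fintype.ofFinite κ
    rw [ENat.card_eq_coe_fintype_card, log2_natCast, entropy, EReal.neg_le]
    exact neg_logb_card_le_channelDivergence_replacer N
  · rw [ENat.card_eq_top_of_infinite, log2_top]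
    exact le_top

variable {A' B' A B : Type}

theorem condEntropy_le_log2_card [Nonempty A'] [Nonempty B'] [Nonempty A]
    (N : Channel (A' × B') (A × B)) : condEntropy N ≤ log2 (ENat.card A) := by
  cases finite_or_infinite A
  · have := Fintype.ofFinite A
    rw [ENat.card_eq_coe_fintype_card, log2_natCast, condEntropy, EReal.neg_le]
    exact le_iInf fun M => neg_logb_card_le_channelDivergence_tensorMap N M
  · rw [ENat.card_eq_top_of_infinite, log2_top]
    exact le_top

theorem neg_log2_card_add_entropy_le_condEntropy [Nonempty B] (N : Channel (A' × B') (A × B)) :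
    -log2 (ENat.card B) + entropy N ≤ condEntropy N := by
  cases finite_or_infinite B
  · have := Fintype.ofFinite B
    rw [ENat.card_eq_coe_fintype_card, log2_natCast, entropy, condEntropy, add_comm,
      ← sub_eq_add_neg, ← EReal.neg_add (.inr (EReal.coe_ne_top _)) (.inr (EReal.coe_ne_bot _)),
      EReal.neg_le_neg_iff]
    exact (iInf_le _ (mixingChannel B' B)).trans (channelDivergence_mixing_le N)
  · rw [ENat.card_eq_top_of_infinite, log2_top, EReal.neg_top, EReal.bot_add]
    exact bot_le

end Entropy

end QuantumChannel

/-! ### The combined statement -/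

theorem mainTheorem6 (A' B' A B : Type)
    [Countable A'] [Countable B'] [Countable A] [Countable B]
    [Nonempty A'] [Nonempty B'] [Nonempty A] [Nonempty B]
    (N : QuantumChannel.Channel (A' × B') (A × B)) :
    - QuantumChannel.log2 (ENat.card B) + QuantumChannel.entropy N
        ≤ QuantumChannel.condEntropy N ∧
    QuantumChannel.condEntropy N ≤ QuantumChannel.log2 (ENat.card A) ∧
    - QuantumChannel.log2 (min (ENat.card A * ENat.card B) (ENat.card A' * ENat.card B'))
        ≤ QuantumChannel.entropy N ∧
    QuantumChannel.entropy N ≤ QuantumChannel.log2 (ENat.card A * ENat.card B) ∧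
    - QuantumChannel.log2 (min (ENat.card A * ENat.card B ^ 2)
          (ENat.card A' * ENat.card B' * ENat.card B))
        ≤ QuantumChannel.condEntropy N := by
  have h₁ := QuantumChannel.neg_log2_card_add_entropy_le_condEntropy N
  have h₃ : - QuantumChannel.log2 (min (ENat.card A * ENat.card B) (ENat.card A' * ENat.card B'))
      ≤ QuantumChannel.entropy N := by
    rw [← ENat.card_prod, ← ENat.card_prod]
    rcases min_choice (ENat.card (A × B)) (ENat.card (A' × B')) with h | h <;> rw [h]
    · exact QuantumChannel.neg_log2_card_output_le_entropy N
    · exact QuantumChannel.neg_log2_card_input_le_entropy N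
  refine ⟨h₁, QuantumChannel.condEntropy_le_log2_card N, h₃, ?_, ?_⟩
  · rw [← ENat.card_prod]
    exact QuantumChannel.entropy_le_log2_card N
  · have hA : ENat.card A ≠ 0 := by simp
    have hB : ENat.card B ≠ 0 := by simp
    have hA' : ENat.card A' ≠ 0 := by simp
    have hB' : ENat.card B' ≠ 0 := by simp
    -- Pulling the common factor `|B|` out of the minimum splits the logarithm into the lower bound
    -- on `S[AB]` and the loss `log |B|`.
    have hmin : min (ENat.card A * ENat.card B ^ 2) (ENat.card A' * ENat.card B' * ENat.card B)
        = min (ENat.card A * ENat.card B) (ENat.card A' * ENat.card B') * ENat.card B := by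
      rw [sq, ← mul_assoc]
      exact ((mul_left_mono (a := ENat.card B)).map_min).symm
    have hmin0 : min (ENat.card A * ENat.card B) (ENat.card A' * ENat.card B') ≠ 0 := by
      rcases min_choice (ENat.card A * ENat.card B) (ENat.card A' * ENat.card B') with h | h <;>
        rw [h] <;> exact mul_ne_zero ‹_› ‹_›
    rw [hmin]
    cases finite_or_infinite B
    · have := Fintype.ofFinite B
      have hc : Fintype.card B ≠ 0 := Fintype.card_ne_zero
      rw [ENat.card_eq_coe_fintype_card (α := B)] at h₁ h₃ hmin0 ⊢
      rw [QuantumChannel.log2_mul_natCast hmin0 hc]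
      refine le_trans ?_ ((add_le_add_right h₃ _).trans h₁)
      rw [QuantumChannel.log2_natCast, EReal.neg_add (.inr (EReal.coe_ne_top _))
        (.inr (EReal.coe_ne_bot _)), sub_eq_add_neg, add_comm]
    -- For infinite `B` the product is `⊤`, as the minimum is nonzero, and the left side is `-∞`.
    · rw [ENat.card_eq_top_of_infinite (α := B), ENat.mul_top (by
        rwa [ENat.card_eq_top_of_infinite (α := B)] at hmin0), QuantumChannel.log2_top,
        EReal.neg_top]
      exact bot_le
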